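/- Let $r_i(t)=(-1)^{\lfloor 2^i t\rfloor}$, $t\in[0,1]$, $i=1,2,\dots$, be the Rademacher functions. For $d\in\mathbb N=\{1,2,\dots\}$ let $\Delta^d$ be the set of all $\vec j=(j_1,\dots,j_d)\in\mathbb N^d$ with $j_1<j_2<\dots<j_d$, let $\Delta^d_n=\{\vec j\in\Delta^d:\ j_d\le n\}$, and let $\mathbf r_{\vec j}=r_{j_1}r_{j_2}\cdots r_{j_d}$. The Rademacher chaos of order $d$ is the system $\{\mathbf r_{\vec j}\}_{\vec j\in\Delta^d}$, enumerated in its natural order: $\vec i\prec\vec j$ if $i_k<j_k$ at the largest $k$ with $i_k\ne j_k$. A sequence $\{x_k\}_{k\ge1}$ in a Banach space $X$ is a RUC system if it is a basic sequence (a Schauder basis of its closed linear span) and there is $D>0$ with $\mathsf E_\theta\|\sum_{k=1}^n\theta_ka_kx_k\|_X\le D\|\sum_{k=1}^na_kx_k\|_X$ for all $n\in\mathbb N$ and $a_k\in\mathbb R$. Here and below $\mathsf E_\theta$ is the average and $\min_\theta$ the minimum over all choices of signs $\theta=\pm1$. For a real array $A=(a_{\vec j})_{\vec j\in\Delta^d_n}$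 put $$\|A\|^*_{cut}=\max_{I\subset\{1,\dots,n\}}\Bigl|\sum_{\vec j\in\Delta^d_n,\ j_1,\dots,j_d\in I}a_{\vec j}\Bigr|.$$ Then for every $d\in\mathbb N$ the following hold. 1. The Rademacher chaos of order $d$ is a RUC system in $L_\infty[0,1]$. In particular, there is a constant $C_d'>0$ such that for all $n\in\mathbb N$ and all $a_{\vec j}\in\mathbb R$, $\vec j\in\Delta^d_n$, $$\mathsf E_\theta\Bigl\|\sum_{\vec j\in\Delta^d_n}\theta_{\vec j}a_{\vec j}\mathbf r_{\vec j}\Bigr\|_{L_\infty[0,1]}\le C_d'\Bigl\|\sum_{\vec j\in\Delta^d_n}a_{\vec j}\mathbf r_{\vec j}\Bigr\|_{L_\infty[0,1]}.$$ 2. For all $n\ge d$ and all real arrays $(a_{\vec j})_{\vec j\in\Delta^d_n}$, with two-sided equivalence constants depending only on $d$, $$\mathsf E_\theta\|(\theta_{\vec j}a_{\vec j})\|^*_{cut}\asymp\min_\theta\|(\theta_{\vec j}a_{\vec j})\|^*_{cut}\asymp\max_{1\le k\le d}\ \sum_{l=1}^n\Bigl(\sum_{\vec j\in\Delta^d_n,\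 j_k=l}a_{\vec j}^2\Bigr)^{1/2}.$$ -/

import Mathlib

open MeasureTheory Filter Topology
open scoped ENNReal BigOperators

noncomputable section

/-- The mean `E_θ F((θ_j b_j)_j)` over all `2^|ι|` arrangements of signs `θ_j = ±1`
(the units of `ℤ` are the signs `±1`). -/
def signMean {ι : Type*} [Fintype ι] [DecidableEq ι] (F : (ι → ℝ) → ℝ) (b : ι → ℝ) : ℝ :=
  𝔼 θ : ι → ℤˣ, F (fun j => ((θ j : ℤ) : ℝ) * b j)

/-- The minimum `min_θ F((θ_j b_j)_j)` over all arrangements of signs `θ_j = ±1`. -/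
def signMin {ι : Type*} [Fintype ι] [DecidableEq ι] (F : (ι → ℝ) → ℝ) (b : ι → ℝ) : ℝ :=
  Finset.univ.inf' Finset.univ_nonempty
    (fun θ : ι → ℤˣ => F (fun j => ((θ j : ℤ) : ℝ) * b j))

/-- A basic sequence in a normed space: a Schauder basis of its closed linear span. -/
def IsBasicSequence {X : Type*} [NormedAddCommGroup X] [NormedSpace ℝ X] (x : ℕ → X) : Prop :=
  ∃ b : SchauderBasis ℝ (Submodule.span ℝ (Set.range x)).topologicalClosure,
    ∀ m, ((b m : (Submodule.span ℝ (Set.range x)).topologicalClosure) : X) = x m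

/-- A system of random unconditional convergence: a basic sequence whose finite sums satisfy
`E_θ ‖∑ θ_k a_k x_k‖ ≤ D ‖∑ a_k x_k‖`. -/
def IsRUCSystem {X : Type*} [NormedAddCommGroup X] [NormedSpace ℝ X] (x : ℕ → X) : Prop :=
  IsBasicSequence x ∧
    ∃ D : ℝ, 0 < D ∧ ∀ (n : ℕ) (a : Fin n → ℝ),
      signMean (fun b => ‖∑ k : Fin n, b k • x k‖) a ≤ D * ‖∑ k : Fin n, a k • x k‖

/-- The Rademacher functions `r_i(t) = (-1)^[2^i t]`, `i = 1, 2, …`. -/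
def rademacher (i : ℕ) (t : ℝ) : ℝ := (-1 : ℝ) ^ ⌊(2 : ℝ) ^ i * t⌋

/-- `Δ^d`, the strictly increasing `d`-tuples of positive integers. -/
def chaosIndex (d : ℕ) : Set (Fin d → ℕ) := {j | (∀ k, 1 ≤ j k) ∧ StrictMono j}

/-- `Δ^d_n`, the strictly increasing `d`-tuples with entries in `{1, …, n}`. -/
def chaosIndexUpTo (d n : ℕ) : Finset (Fin d → ℕ) :=
  {j ∈ Fintype.piFinset (fun _ : Fin d => Finset.Icc 1 n) | StrictMono j}

/-- The natural order of the chaos: tuples are compared at the last place where they differ. -/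
def chaosLT {d : ℕ} (i j : Fin d → ℕ) : Prop :=
  ∃ k, i k < j k ∧ ∀ l, k < l → i l = j l

/-- `L_∞[0,1]`. -/
abbrev LinftyUnit : Type := Lp ℝ ∞ (volume.restrict (Set.Icc (0 : ℝ) 1))

theorem measurable_rademacher (i : ℕ) : Measurable (rademacher i) := by
  have h : Measurable fun z : ℤ => (-1 : ℝ) ^ z := measurable_from_top
  exact h.comp (Int.measurable_floor.comp (measurable_const.mul measurable_id))

theorem abs_rademacher (i : ℕ) (t : ℝ) : |rademacher i t| = 1 := by
  simp [rademacher, abs_zpow]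

theorem memLp_chaos {d : ℕ} (j : Fin d → ℕ) :
    MemLp (fun t => ∏ k, rademacher (j k) t) ∞ (volume.restrict (Set.Icc (0 : ℝ) 1)) := by
  refine memLp_top_of_bound (C := 1) ?_ ?_
  · exact (Finset.measurable_prod _
      (fun k _ => measurable_rademacher (j k))).aestronglyMeasurable
  · exact Eventually.of_forall fun t => by
      simp [abs_rademacher]

/-- `r_{j_1} r_{j_2} ⋯ r_{j_d}` as an element of `L_∞[0,1]`. -/
def chaosFun {d : ℕ} (j : Fin d → ℕ) : LinftyUnit := (memLp_chaos j).toLp _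

/-- The modified cut-norm
`max_{I ⊆ {1,…,n}} |∑_{j ∈ Δ^d_n, j_1, …, j_d ∈ I} a_j|` of a strictly upper triangular array. -/
def modifiedCutNorm {d n : ℕ} (a : chaosIndexUpTo d n → ℝ) : ℝ :=
  (Finset.Icc 1 n).powerset.sup' (Finset.powerset_nonempty _)
    (fun I => |∑ j : chaosIndexUpTo d n with ∀ k, j.1 k ∈ I, a j|)

/-- `max_{1 ≤ k ≤ d} ∑_{l=1}^n (∑_{j ∈ Δ^d_n, j_k = l} a_j ^ 2)^{1/2}`. -/
def maxMixedNorm {d n : ℕ} (a : chaosIndexUpTo d n → ℝ) : ℝ :=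
  ⨆ k : Fin d, ∑ l ∈ Finset.Icc 1 n, √(∑ j : chaosIndexUpTo d n with j.1 k = l, a j ^ 2)

end

/-! All the norms involved are compared with mixed norms of the coefficients, which ignore signs.
Write `P` for the homogeneous multi-affine polynomial of degree `d` with the given coefficients.
Every sign pattern of finitely many Rademacher functions occurs on a dyadic interval, so the `L_∞`
norm of the chaos is the maximum of `|P|` over sign vectors, equivalently over the cube `[-1,1]^N`.

Lower bound (`exists_incidenceNorm_le`). At a sign vector `ε` choose the direction `y` of the signs
of the partial derivatives. Then `t ↦ P(ε + t y)` has degree at most `d`, is bounded on `[0,1]` by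
`2^d` times the supremum, and has derivative `∑ l, |∂_l P(ε)|` at `0`. A Markov-type bound controls
this sum. Averaging over `ε` and applying Khinchin's inequality for chaos (from Bonami's fourth
moment bound) to each `∂_l P` gives square functions.

Upper bound (`expect_iSup_decoupled_le`). With random coefficient signs and an independent sign
family in each of the `d` places, maximizing over the last family leaves a sum of absolute values
over the fibres of the last index. Symmetrization and the contraction principle replace it by a
mixed norm plus twice the same quantity with one place fewer, and one inducts on `d`.

Together these give random unconditionality. The cut norm is the supremum of `|P|` over
`{0,1}`-vectors, which is comparable to the supremum over sign vectors by extrapolating a polynomial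
of degree at most `d` from `[0,1]` to `-1`. The lower bound holds for every choice of signs with the
same mixed norm, so even the minimum over signs is comparable to the mean.

For the basic sequence property, an initial segment of the natural order consists of all tuples with
last entry below some `N` and an initial segment of those with last entry `N`. Both blocks are
reached by setting variables to `0` or `1`, and induction on `d` bounds the partial sum projections
by `3^d`. -/

noncomputable section

/-! ### Walsh sums: Bonami's inequality and Khinchin's inequality -/

/-- The point of `{1, -1}^α` whose set of negative coordinates is `A`. -/
def signOf {α : Type*} [DecidableEq α] (A : Finset α) (i : α) : ℝ := if i ∈ A then -1 else 1

theorem abs_signOf {α : Type*} [DecidableEq α] (A : Finset α) (i : α) : |signOf A i| = 1 := by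
  unfold signOf; split_ifs <;> simp

/-- The Walsh sum with coefficients `c`, over the subsets of `s`, at the point `signOf A`. -/
def walshSum {α : Type*} [DecidableEq α] (s : Finset α) (c : Finset α → ℝ) (A : Finset α) : ℝ :=
  ∑ S ∈ s.powerset, c S * ∏ i ∈ S, signOf A i

section Walsh

variable {α : Type*} [DecidableEq α] {s : Finset α} {m : α}

theorem walshSum_insert_of_subset (hm : m ∉ s) (c : Finset α → ℝ) {A : Finset α} (hA : A ⊆ s) :
    walshSum (insert m s) c A = walshSum s c A + walshSum s (fun S => c (insert m S)) A := by
  unfold walshSum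
  rw [Finset.sum_powerset_insert hm]
  congr 1
  refine Finset.sum_congr rfl fun S hS => ?_
  have hmS : m ∉ S := fun h => hm (Finset.mem_powerset.1 hS h)
  have hmA : m ∉ A := fun h => hm (hA h)
  rw [Finset.prod_insert hmS]
  simp [signOf, hmA]

theorem walshSum_insert_insert (hm : m ∉ s) (c : Finset α → ℝ) (A : Finset α) :
    walshSum (insert m s) c (insert m A)
      = walshSum s c A - walshSum s (fun S => c (insert m S)) A := by
  unfold walshSum
  rw [Finset.sum_powerset_insert hm, sub_eq_add_neg, ← Finset.sum_neg_distrib]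
  have key : ∀ S ∈ s.powerset, ∏ i ∈ S, signOf (insert m A) i = ∏ i ∈ S, signOf A i := by
    intro S hS
    refine Finset.prod_congr rfl fun i hi => ?_
    have : i ≠ m := fun h => hm (h ▸ Finset.mem_powerset.1 hS hi)
    simp [signOf, this]
  congr 1
  · exact Finset.sum_congr rfl fun S hS => by rw [key S hS]
  · refine Finset.sum_congr rfl fun S hS => ?_
    have hmS : m ∉ S := fun h => hm (Finset.mem_powerset.1 hS h)
    rw [Finset.prod_insert hmS, key S hS]
    simp [signOf]

/-- Splitting off the coordinate `m` writes the Walsh sum as `g + ε_m h`; this is the induction step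
for all moments. -/
theorem sum_comp_walshSum_insert (hm : m ∉ s) (c : Finset α → ℝ) (φ : ℝ → ℝ) :
    ∑ A ∈ (insert m s).powerset, φ (walshSum (insert m s) c A)
      = ∑ A ∈ s.powerset,
          (φ (walshSum s c A + walshSum s (fun S => c (insert m S)) A)
            + φ (walshSum s c A - walshSum s (fun S => c (insert m S)) A)) := by
  rw [Finset.sum_powerset_insert hm, ← Finset.sum_add_distrib]
  refine Finset.sum_congr rfl fun A hA => ?_
  have hA := Finset.mem_powerset.1 hA
  rw [walshSum_insert_of_subset hm c hA, walshSum_insert_insert hm c A]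

theorem sum_walshSum_sq (s : Finset α) (c : Finset α → ℝ) :
    ∑ A ∈ s.powerset, walshSum s c A ^ 2 = 2 ^ s.card * ∑ S ∈ s.powerset, c S ^ 2 := by
  induction s using Finset.induction_on generalizing c with
  | empty => simp [walshSum]
  | insert m s hm ih =>
    rw [sum_comp_walshSum_insert hm c (fun x => x ^ 2), Finset.sum_powerset_insert hm,
      Finset.card_insert_of_notMem hm]
    have h : ∀ A ∈ s.powerset,
        (walshSum s c A + walshSum s (fun S => c (insert m S)) A) ^ 2
          + (walshSum s c A - walshSum s (fun S => c (insert m S)) A) ^ 2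
        = 2 * walshSum s c A ^ 2 + 2 * walshSum s (fun S => c (insert m S)) A ^ 2 :=
      fun A _ => by ring
    rw [Finset.sum_congr rfl h, Finset.sum_add_distrib, ← Finset.mul_sum, ← Finset.mul_sum,
      ih, ih]
    ring

/-- Bonami's inequality between the fourth and the second moments of a Walsh sum of degree at
most `r`. -/
theorem sum_walshSum_pow_four_le (s : Finset α) (c : Finset α → ℝ) (r : ℕ)
    (hc : ∀ S ∈ s.powerset, r < S.card → c S = 0) :
    2 ^ s.card * ∑ A ∈ s.powerset, walshSum s c A ^ 4
      ≤ 9 ^ r * (∑ A ∈ s.powerset, walshSum s c A ^ 2) ^ 2 := by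
  induction s using Finset.induction_on generalizing c r with
  | empty =>
    simp only [walshSum, Finset.powerset_empty, Finset.sum_singleton, Finset.prod_empty,
      Finset.card_empty]
    have : (1 : ℝ) ≤ 9 ^ r := one_le_pow₀ (by norm_num)
    nlinarith [sq_nonneg (c ∅ ^ 2)]
  | insert m s hm ih =>
    rw [sum_comp_walshSum_insert hm c (fun x => x ^ 2),
      sum_comp_walshSum_insert hm c (fun x => x ^ 4), Finset.card_insert_of_notMem hm]
    -- The sum is `g + ε_m h` with `h` of degree at most `r - 1`; odd powers of `h` cancel on
    -- averaging over `ε_m`.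
    set c' : Finset α → ℝ := fun S => c (insert m S) with hc'
    set g := walshSum s c with hg
    set h := walshSum s c' with hh
    have e4 : ∑ A ∈ s.powerset, ((g A + h A) ^ 4 + (g A - h A) ^ 4)
        = 2 * ∑ A ∈ s.powerset, g A ^ 4 + 12 * ∑ A ∈ s.powerset, g A ^ 2 * h A ^ 2
          + 2 * ∑ A ∈ s.powerset, h A ^ 4 := by
      rw [Finset.mul_sum, Finset.mul_sum, Finset.mul_sum, ← Finset.sum_add_distrib,
        ← Finset.sum_add_distrib]
      exact Finset.sum_congr rfl fun A _ => by ring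
    have e2 : ∑ A ∈ s.powerset, ((g A + h A) ^ 2 + (g A - h A) ^ 2)
        = 2 * ∑ A ∈ s.powerset, g A ^ 2 + 2 * ∑ A ∈ s.powerset, h A ^ 2 := by
      rw [Finset.mul_sum, Finset.mul_sum, ← Finset.sum_add_distrib]
      exact Finset.sum_congr rfl fun A _ => by ring
    rw [e4, e2]
    have hsub : ∀ S ∈ s.powerset, S ∈ (insert m s).powerset := fun S hS =>
      Finset.mem_powerset.2 ((Finset.mem_powerset.1 hS).trans (Finset.subset_insert _ _))
    have hmS : ∀ S ∈ s.powerset, m ∉ S := fun S hS h => hm (Finset.mem_powerset.1 hS h)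
    have hins : ∀ S ∈ s.powerset, insert m S ∈ (insert m s).powerset := fun S hS =>
      Finset.mem_powerset.2 (Finset.insert_subset_insert _ (Finset.mem_powerset.1 hS))
    have ihg := ih c r (fun S hS => hc S (hsub S hS))
    rw [← hg] at ihg
    have cs : (∑ A ∈ s.powerset, g A ^ 2 * h A ^ 2) ^ 2
        ≤ (∑ A ∈ s.powerset, g A ^ 4) * ∑ A ∈ s.powerset, h A ^ 4 :=
      Finset.sum_sq_le_sum_mul_sum_of_sq_le_mul _ (fun _ _ => by positivity)
        (fun _ _ => by positivity) (fun _ _ => (by ring : _ = _).le)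
    -- The lower degree of `h` gains the factor `1/9`; for `r = 0` the function `h` vanishes.
    have ihh : 2 ^ s.card * ∑ A ∈ s.powerset, h A ^ 4
        ≤ 9 ^ r / 9 * (∑ A ∈ s.powerset, h A ^ 2) ^ 2 := by
      rcases Nat.eq_zero_or_pos r with rfl | hr
      · have h0 : ∀ A, h A = 0 := fun A => by
          rw [hh, walshSum]
          refine Finset.sum_eq_zero fun S hS => ?_
          have : c' S = 0 := hc _ (hins S hS) (by
            rw [Finset.card_insert_of_notMem (hmS S hS)]; omega)
          rw [this, zero_mul]
        simp [h0]
      · obtain ⟨q, rfl⟩ : ∃ q, r = q + 1 := ⟨r - 1, by omega⟩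
        have := ih c' q (fun S hS hq => hc _ (hins S hS) (by
          rw [Finset.card_insert_of_notMem (hmS S hS)]; omega))
        rw [← hh] at this
        rw [pow_succ, mul_div_assoc]
        norm_num
        exact this
    set G4 := ∑ A ∈ s.powerset, g A ^ 4
    set H4 := ∑ A ∈ s.powerset, h A ^ 4
    set G2 := ∑ A ∈ s.powerset, g A ^ 2
    set H2 := ∑ A ∈ s.powerset, h A ^ 2
    set X := ∑ A ∈ s.powerset, g A ^ 2 * h A ^ 2
    have hG2 : 0 ≤ G2 := Finset.sum_nonneg fun _ _ => by positivity
    have hH2 : 0 ≤ H2 := Finset.sum_nonneg fun _ _ => by positivity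
    have hG4 : 0 ≤ G4 := Finset.sum_nonneg fun _ _ => by positivity
    have hH4 : 0 ≤ H4 := Finset.sum_nonneg fun _ _ => by positivity
    have hN : (0 : ℝ) < 9 ^ r := by positivity
    have hT : (0 : ℝ) < 2 ^ s.card := by positivity
    -- Cauchy–Schwarz gives the geometric mean of the two bounds. Since `24 / 3 = 8`, this is
    -- exactly the cross term of `(2 G2 + 2 H2) ^ 2`.
    have hX : 2 ^ s.card * X ≤ 9 ^ r / 3 * (G2 * H2) := by
      refine abs_le_of_sq_le_sq' ?_ (by positivity) |>.2
      calc (2 ^ s.card * X) ^ 2 = (2 ^ s.card) ^ 2 * X ^ 2 := by ring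
        _ ≤ (2 ^ s.card) ^ 2 * (G4 * H4) := by gcongr
        _ = (2 ^ s.card * G4) * (2 ^ s.card * H4) := by ring
        _ ≤ (9 ^ r * G2 ^ 2) * (9 ^ r / 9 * H2 ^ 2) := by gcongr
        _ = (9 ^ r / 3 * (G2 * H2)) ^ 2 := by ring
    have : 9 ^ r / 9 * H2 ^ 2 ≤ 9 ^ r * H2 ^ 2 := by gcongr; linarith
    calc (2 : ℝ) ^ (s.card + 1) * (2 * G4 + 12 * X + 2 * H4)
        = 4 * (2 ^ s.card * G4) + 24 * (2 ^ s.card * X) + 4 * (2 ^ s.card * H4) := by ring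
      _ ≤ 4 * (9 ^ r * G2 ^ 2) + 24 * (9 ^ r / 3 * (G2 * H2)) + 4 * (9 ^ r * H2 ^ 2) := by
        linarith
      _ = 9 ^ r * (2 * G2 + 2 * H2) ^ 2 := by ring

/-- The first moment of a Walsh sum of degree at most `r` dominates its second moment. -/
theorem sqrt_sum_sq_le_sum_abs_walshSum (s : Finset α) (c : Finset α → ℝ) (r : ℕ)
    (hc : ∀ S ∈ s.powerset, r < S.card → c S = 0) :
    2 ^ s.card * √(∑ S ∈ s.powerset, c S ^ 2)
      ≤ 3 ^ r * ∑ A ∈ s.powerset, |walshSum s c A| := by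
  have h4 := sum_walshSum_pow_four_le s c r hc
  have h2 := sum_walshSum_sq s c
  set f := walshSum s c
  -- Hölder interpolation of the second moment between the first and the fourth, as two uses of
  -- Cauchy–Schwarz through the third.
  have a1 : (∑ A ∈ s.powerset, f A ^ 2) ^ 2
      ≤ (∑ A ∈ s.powerset, |f A|) * ∑ A ∈ s.powerset, |f A| ^ 3 :=
    Finset.sum_sq_le_sum_mul_sum_of_sq_le_mul _ (fun _ _ => by positivity)
      (fun _ _ => by positivity) (fun A _ => by rw [← sq_abs (f A)]; exact (by ring : _ = _).le)
  have a2 : (∑ A ∈ s.powerset, |f A| ^ 3) ^ 2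
      ≤ (∑ A ∈ s.powerset, f A ^ 2) * ∑ A ∈ s.powerset, f A ^ 4 :=
    Finset.sum_sq_le_sum_mul_sum_of_sq_le_mul _ (fun _ _ => by positivity)
      (fun _ _ => by positivity) (fun A _ => by
        rw [← pow_mul, mul_comm 3 2, pow_mul, sq_abs]; exact (by ring : _ = _).le)
  have hC : 0 ≤ ∑ S ∈ s.powerset, c S ^ 2 := Finset.sum_nonneg fun _ _ => by positivity
  set Q := ∑ S ∈ s.powerset, c S ^ 2
  set F1 := ∑ A ∈ s.powerset, |f A|
  set F2 := ∑ A ∈ s.powerset, f A ^ 2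
  set F3 := ∑ A ∈ s.powerset, |f A| ^ 3
  set F4 := ∑ A ∈ s.powerset, f A ^ 4
  have hF1 : 0 ≤ F1 := Finset.sum_nonneg fun _ _ => by positivity
  have hF3 : 0 ≤ F3 := Finset.sum_nonneg fun _ _ => by positivity
  have hT : (0 : ℝ) < 2 ^ s.card := by positivity
  rcases hC.eq_or_lt with h0 | hpos
  · rw [← h0]; simp; positivity
  have hF2 : 0 < F2 := by rw [h2]; positivity
  have b : 2 ^ s.card * F2 ≤ 9 ^ r * F1 ^ 2 := by
    have b1 : F2 ^ 4 ≤ F1 ^ 2 * (F2 * F4) := by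
      calc F2 ^ 4 = (F2 ^ 2) ^ 2 := by ring
        _ ≤ (F1 * F3) ^ 2 := by gcongr
        _ = F1 ^ 2 * F3 ^ 2 := by ring
        _ ≤ _ := by gcongr
    have b2 : F2 ^ 3 * (2 ^ s.card * F2) ≤ F2 ^ 3 * (9 ^ r * F1 ^ 2) := by
      calc F2 ^ 3 * (2 ^ s.card * F2) = 2 ^ s.card * F2 ^ 4 := by ring
        _ ≤ 2 ^ s.card * (F1 ^ 2 * (F2 * F4)) := by gcongr
        _ = F1 ^ 2 * F2 * (2 ^ s.card * F4) := by ring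
        _ ≤ F1 ^ 2 * F2 * (9 ^ r * F2 ^ 2) := by gcongr
        _ = _ := by ring
    exact le_of_mul_le_mul_left b2 (by positivity)
  refine abs_le_of_sq_le_sq' ?_ (by positivity) |>.2
  rw [mul_pow, Real.sq_sqrt hC, mul_pow, ← pow_mul 3, mul_comm r 2, pow_mul 3]
  norm_num only
  calc (2 ^ s.card) ^ 2 * Q = 2 ^ s.card * F2 := by rw [h2]; ring
    _ ≤ _ := b

end Walsh

/-! ### Multi-affine polynomials on cubes and along lines -/

/-- The multi-affine polynomial `∑ i, a i * ∏ m ∈ S i, x m`. -/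
def chaosPoly {ι : Type*} [Fintype ι] (S : ι → Finset ℕ) (a : ι → ℝ) (x : ℕ → ℝ) : ℝ :=
  ∑ i, a i * ∏ m ∈ S i, x m

/-- Khinchin's inequality for chaos sums of order at most `r`. -/
theorem sqrt_sum_sq_le_sum_abs_chaosPoly {ι : Type*} [Fintype ι] {S : ι → Finset ℕ}
    (hS : Function.Injective S) {N r : ℕ} (hN : ∀ i, S i ⊆ Finset.range N)
    (hr : ∀ i, (S i).card ≤ r) (a : ι → ℝ) :
    2 ^ N * √(∑ i, a i ^ 2)
      ≤ 3 ^ r * ∑ A ∈ (Finset.range N).powerset, |chaosPoly S a (signOf A)| := by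
  classical
  -- As `S` is injective, each sum has at most one term: this turns the family into Walsh
  -- coefficients.
  set c : Finset ℕ → ℝ := fun T => ∑ i with S i = T, a i with hc
  have hcS : ∀ i, c (S i) = a i := fun i => by
    have : Finset.univ.filter (fun k => S k = S i) = {i} := by
      ext k; simp [hS.eq_iff]
    simp [hc, this]
  have h0 : ∀ T, (∀ i, S i ≠ T) → c T = 0 := fun T hT => by simp [hc, hT]
  have key : ∀ φ : Finset ℕ → ℝ, (∀ T, (∀ i, S i ≠ T) → φ T = 0) →
      ∑ T ∈ (Finset.range N).powerset, φ T = ∑ i, φ (S i) := fun φ hφ => by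
    rw [← Finset.sum_image (s := Finset.univ) (g := S) (f := φ) (by simp [hS.injOn])]
    symm
    refine Finset.sum_subset ?_ ?_
    · intro T hT
      obtain ⟨i, -, rfl⟩ := Finset.mem_image.1 hT
      exact Finset.mem_powerset.2 (hN i)
    · intro T _ hT
      refine hφ T fun i hi => hT (Finset.mem_image.2 ⟨i, Finset.mem_univ _, hi⟩)
  have := sqrt_sum_sq_le_sum_abs_walshSum (Finset.range N) c r (fun T _ hT => h0 T (by
    rintro i rfl; exact absurd (hr i) (not_le.2 hT)))
  rw [key (fun T => c T ^ 2) (fun T hT => by simp [h0 T hT]), Finset.card_range] at this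
  simp only [hcS] at this
  refine this.trans_eq ?_
  congr 1
  refine Finset.sum_congr rfl fun A _ => ?_
  rw [walshSum, key (fun T => c T * ∏ i ∈ T, signOf A i) (fun T hT => by simp [h0 T hT])]
  simp only [hcS, chaosPoly]

section MultiAffine

variable {ι : Type*} [Fintype ι] (S : ι → Finset ℕ) (a : ι → ℝ)

theorem chaosPoly_congr {x y : ℕ → ℝ} (h : ∀ i, ∀ m ∈ S i, x m = y m) :
    chaosPoly S a x = chaosPoly S a y :=
  Finset.sum_congr rfl fun i _ => by rw [Finset.prod_congr rfl (h i)]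

/-- Each monomial contains `x m` at most once, so the polynomial is affine in each variable. -/
theorem chaosPoly_update (x : ℕ → ℝ) (m : ℕ) (p q t : ℝ) :
    chaosPoly S a (Function.update x m ((1 - t) * p + t * q))
      = (1 - t) * chaosPoly S a (Function.update x m p)
        + t * chaosPoly S a (Function.update x m q) := by
  unfold chaosPoly
  rw [Finset.mul_sum, Finset.mul_sum, ← Finset.sum_add_distrib]
  refine Finset.sum_congr rfl fun i _ => ?_
  by_cases hm : m ∈ S i
  · have key : ∀ u : ℝ, ∏ k ∈ S i, Function.update x m u k = u * ∏ k ∈ (S i).erase m, x k := by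
      intro u
      rw [← Finset.mul_prod_erase _ _ hm]
      simp only [Function.update_self]
      congr 1
      exact Finset.prod_congr rfl fun k hk => Function.update_of_ne (Finset.ne_of_mem_erase hk) _ _
    simp only [key]
    ring
  · have key : ∀ u : ℝ, ∏ k ∈ S i, Function.update x m u k = ∏ k ∈ S i, x k := fun u =>
      Finset.prod_congr rfl fun k hk =>
        Function.update_of_ne (fun h => hm (by rwa [h] at hk)) _ _
    simp only [key]
    ring

variable {S a}

/-- A bound of a multi-affine polynomial at the vertices of a cube holds on the whole cube. -/
theorem abs_chaosPoly_le_of_mem_Icc {K p q : ℝ} (hpq : p < q)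
    (hK : ∀ y : ℕ → ℝ, (∀ m, y m = p ∨ y m = q) → |chaosPoly S a y| ≤ K)
    {x : ℕ → ℝ} (hx : ∀ m, x m ∈ Set.Icc p q) : |chaosPoly S a x| ≤ K := by
  -- Only the coordinates in `s` are off the vertices; they are moved to an endpoint one at a time,
  -- by affinity.
  have step : ∀ s : Finset ℕ, ∀ y : ℕ → ℝ, (∀ m, y m ∈ Set.Icc p q) →
      (∀ m ∉ s, y m = p ∨ y m = q) → |chaosPoly S a y| ≤ K := by
    intro s
    induction s using Finset.induction_on with
    | empty => exact fun y _ h => hK y fun m => h m (by simp)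
    | insert m s hm ih =>
      intro y hy hys
      have hb : ∀ u : ℝ, u = p ∨ u = q → |chaosPoly S a (Function.update y m u)| ≤ K := by
        intro u hu
        refine ih _ (fun k => ?_) fun k hk => ?_
        · rcases eq_or_ne k m with rfl | h
          · rcases hu with rfl | rfl <;> simp [hpq.le]
          · rw [Function.update_of_ne h]; exact hy k
        · rcases eq_or_ne k m with rfl | h
          · simpa using hu
          · rw [Function.update_of_ne h]; exact hys k (by simp [h, hk])
      have h1 := hb p (Or.inl rfl)
      have h2 := hb q (Or.inr rfl)
      have hpq' : 0 < q - p := sub_pos.2 hpq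
      obtain ⟨hp, hq⟩ := hy m
      set t := (y m - p) / (q - p) with ht
      have p2 : 0 ≤ t := div_nonneg (by linarith) hpq'.le
      have p1 : 0 ≤ 1 - t := by
        rw [sub_nonneg, ht, div_le_one hpq']; linarith
      have hyt : y m = (1 - t) * p + t * q := by rw [ht]; field_simp; ring
      rw [← Function.update_eq_self m y, hyt, chaosPoly_update]
      calc _ ≤ |(1 - t) * chaosPoly S a (Function.update y m p)|
            + |t * chaosPoly S a (Function.update y m q)| := abs_add_le _ _
        _ = (1 - t) * |chaosPoly S a (Function.update y m p)|
            + t * |chaosPoly S a (Function.update y m q)| := by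
          rw [abs_mul, abs_mul, abs_of_nonneg p1, abs_of_nonneg p2]
        _ ≤ (1 - t) * K + t * K := by gcongr
        _ = K := by ring
  classical
  set s := Finset.univ.biUnion S
  -- Coordinates that occur in no monomial are reset to `p`, which leaves finitely many to move.
  rw [chaosPoly_congr S a (y := fun m => if m ∈ s then x m else p) fun i m hm => by
    rw [if_pos (Finset.mem_biUnion.2 ⟨i, Finset.mem_univ _, hm⟩)]]
  refine step s _ (fun m => ?_) fun m hm => by simp [hm]
  split_ifs
  exacts [hx m, ⟨le_rfl, hpq.le⟩]

/-- A bound of a multi-affine polynomial at all sign vectors holds on the whole cube. -/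
theorem abs_chaosPoly_le_of_abs_le_one {K : ℝ}
    (hK : ∀ ε : ℕ → ℝ, (∀ m, |ε m| = 1) → |chaosPoly S a ε| ≤ K)
    {x : ℕ → ℝ} (hx : ∀ m, |x m| ≤ 1) : |chaosPoly S a x| ≤ K :=
  abs_chaosPoly_le_of_mem_Icc (p := -1) (q := 1) (by norm_num)
    (fun y hy => hK y fun m => by rcases hy m with h | h <;> simp [h]) fun m => abs_le.1 (hx m)

/-- The restriction of a multi-affine polynomial to a line. -/
def linePoly (S : ι → Finset ℕ) (a : ι → ℝ) (x y : ℕ → ℝ) : Polynomial ℝ :=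
  ∑ i, Polynomial.C (a i) * ∏ m ∈ S i, (Polynomial.C (x m) + Polynomial.C (y m) * Polynomial.X)

theorem eval_linePoly (x y : ℕ → ℝ) (t : ℝ) :
    (linePoly S a x y).eval t = chaosPoly S a (fun m => x m + t * y m) := by
  simp [linePoly, chaosPoly, Polynomial.eval_finsetSum, Polynomial.eval_prod, mul_comm t]

theorem natDegree_linePoly_le {d : ℕ} (hd : ∀ i, (S i).card ≤ d) (x y : ℕ → ℝ) :
    (linePoly S a x y).natDegree ≤ d := by
  refine Polynomial.natDegree_sum_le_of_forall_le _ _ fun i _ => ?_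
  refine (Polynomial.natDegree_C_mul_le _ _).trans ?_
  refine (Polynomial.natDegree_prod_le _ _).trans ?_
  refine (Finset.sum_le_card_nsmul _ _ 1 fun m _ => ?_).trans (by simpa using hd i)
  compute_degree

/-- The partial derivative of a multi-affine polynomial in the direction `l`. -/
def chaosDeriv (S : ι → Finset ℕ) (a : ι → ℝ) (l : ℕ) (x : ℕ → ℝ) : ℝ :=
  chaosPoly (fun i : {i // l ∈ S i} => (S i.1).erase l) (fun i => a i.1) x

theorem chaosDeriv_eq (l : ℕ) (x : ℕ → ℝ) :
    chaosDeriv S a l x = ∑ i with l ∈ S i, a i * ∏ m ∈ (S i).erase l, x m := by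
  rw [chaosDeriv, chaosPoly,
    ← Finset.sum_subtype_eq_sum_filter, Finset.subtype_univ]

theorem eval_derivative_linePoly {N : ℕ} (hN : ∀ i, S i ⊆ Finset.range N) (x y : ℕ → ℝ) :
    (Polynomial.derivative (linePoly S a x y)).eval 0
      = ∑ l ∈ Finset.range N, y l * chaosDeriv S a l x := by
  simp only [chaosDeriv_eq, Finset.sum_filter, linePoly, Polynomial.derivative_sum,
    Polynomial.eval_finsetSum, Polynomial.derivative_C_mul, Finset.mul_sum]
  rw [Finset.sum_comm]
  refine Finset.sum_congr rfl fun i _ => ?_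
  rw [← Finset.sum_subset (hN i) (fun l _ hl => by simp [hl]), Polynomial.derivative_prod_finset,
    Polynomial.eval_C_mul, Polynomial.eval_finsetSum, Finset.mul_sum]
  refine Finset.sum_congr rfl fun l hl => ?_
  simp [hl, Polynomial.eval_prod]
  ring

end MultiAffine

/-! ### The supremum norm dominates the incidence norm -/

/-- A linear functional on polynomials of degree at most `d` is bounded by the supremum over the
unit interval. -/
theorem exists_abs_le_of_natDegree_le (d : ℕ) (φ : Polynomial ℝ →ₗ[ℝ] ℝ) :
    ∃ C : ℝ, 0 < C ∧ ∀ (p : Polynomial ℝ) (K : ℝ), p.natDegree ≤ d →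
      (∀ t : ℝ, 0 ≤ t → t ≤ 1 → |p.eval t| ≤ K) → |φ p| ≤ C * K := by
  -- Lagrange interpolation at `d + 1` nodes of `[0,1]`; the added `1` in the constant only makes it
  -- positive.
  set v : ℕ → ℝ := fun k => k / (d + 1) with hv
  have hinj : Set.InjOn v (Finset.range (d + 1)) := by
    intro k _ l _ h
    have : (d + 1 : ℝ) ≠ 0 := by positivity
    simp only [hv] at h
    field_simp at h
    exact_mod_cast h
  set B := Lagrange.basis (Finset.range (d + 1)) v
  refine ⟨∑ k ∈ Finset.range (d + 1), |φ (B k)| + 1, by positivity, fun p K hp hK => ?_⟩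
  have hK0 : 0 ≤ K := (abs_nonneg _).trans (hK 0 le_rfl zero_le_one)
  have hdeg : p.degree < (Finset.range (d + 1)).card := by
    rw [Finset.card_range]
    exact Polynomial.degree_le_natDegree.trans_lt (by exact_mod_cast Nat.lt_succ_of_le hp)
  have e := Lagrange.eq_interpolate hinj hdeg
  rw [Lagrange.interpolate_apply] at e
  rw [e, map_sum]
  calc _ ≤ ∑ k ∈ Finset.range (d + 1), |φ (Polynomial.C (p.eval (v k)) * B k)| :=
        Finset.abs_sum_le_sum_abs _ _
    _ ≤ ∑ k ∈ Finset.range (d + 1), |φ (B k)| * K := by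
      refine Finset.sum_le_sum fun k hk => ?_
      rw [← Polynomial.smul_eq_C_mul, map_smul, smul_eq_mul, abs_mul, mul_comm]
      gcongr
      refine hK _ (by positivity) ?_
      rw [hv, div_le_one (by positivity)]
      have : k < d + 1 := Finset.mem_range.1 hk
      exact_mod_cast this.le
    _ ≤ _ := by rw [← Finset.sum_mul]; nlinarith

/-- The sum `∑ l, (∑ (a i)²)^{1/2}` with the inner sum over all `i` for which `S i` contains `l`. -/
def incidenceNorm {ι : Type*} [Fintype ι] (S : ι → Finset ℕ) (a : ι → ℝ) (N : ℕ) : ℝ :=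
  ∑ l ∈ Finset.range N, √(∑ i with l ∈ S i, a i ^ 2)

/-- The supremum norm of a homogeneous chaos dominates its incidence norm. -/
theorem exists_incidenceNorm_le (d : ℕ) :
    ∃ C : ℝ, 0 < C ∧ ∀ {ι : Type} [Fintype ι] (S : ι → Finset ℕ) (a : ι → ℝ) (N : ℕ) (K : ℝ),
      Function.Injective S → (∀ i, S i ⊆ Finset.range N) → (∀ i, (S i).card = d) →
      (∀ ε : ℕ → ℝ, (∀ m, |ε m| = 1) → |chaosPoly S a ε| ≤ K) →
      incidenceNorm S a N ≤ C * K := by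
  obtain ⟨C, hC, h⟩ := exists_abs_le_of_natDegree_le d
    ((Polynomial.leval (0 : ℝ)).comp Polynomial.derivative)
  refine ⟨3 ^ d * (C * 2 ^ d), by positivity, fun {ι} _ S a N K hS hN hd hK => ?_⟩
  have hderiv : ∀ ε : ℕ → ℝ, (∀ m, |ε m| = 1) →
      ∑ l ∈ Finset.range N, |chaosDeriv S a l ε| ≤ C * 2 ^ d * K := by
    intro ε hε
    -- This direction makes the directional derivative equal to the `ℓ_1` norm of the gradient.
    set y : ℕ → ℝ := fun l => SignType.sign (chaosDeriv S a l ε) with hy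
    have hy1 : ∀ l, |y l| ≤ 1 := fun l => by
      simp only [hy]
      rcases lt_trichotomy (chaosDeriv S a l ε) 0 with h | h | h <;> simp [h]
    have e : ∑ l ∈ Finset.range N, |chaosDeriv S a l ε|
        = ((Polynomial.leval (0 : ℝ)).comp Polynomial.derivative) (linePoly S a ε y) := by
      rw [LinearMap.comp_apply, Polynomial.leval_apply, eval_derivative_linePoly hN]
      exact Finset.sum_congr rfl fun l _ => (sign_mul_self _).symm
    rw [e, mul_assoc]
    refine (le_abs_self _).trans (h _ _ (natDegree_linePoly_le (fun i => (hd i).le) _ _) ?_)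
    intro t ht0 ht1
    rw [eval_linePoly]
    -- The points `ε + t y` lie in `[-2,2]^N`; homogeneity brings them back to the unit cube at the
    -- cost `2 ^ d`.
    have hom : chaosPoly S a (fun m => ε m + t * y m)
        = 2 ^ d * chaosPoly S a (fun m => (ε m + t * y m) / 2) := by
      unfold chaosPoly
      rw [Finset.mul_sum]
      refine Finset.sum_congr rfl fun i _ => ?_
      rw [Finset.prod_div_distrib, Finset.prod_const, hd]
      field_simp
    rw [hom, abs_mul, abs_of_pos (by positivity : (0 : ℝ) < 2 ^ d)]
    gcongr
    refine abs_chaosPoly_le_of_abs_le_one hK fun m => ?_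
    rw [abs_div, abs_two, div_le_one (by norm_num)]
    refine (abs_add_le _ _).trans ?_
    rw [hε, abs_mul, abs_of_nonneg ht0]
    have := mul_le_mul ht1 (hy1 m) (abs_nonneg _) zero_le_one
    linarith
  have hkh : ∀ l, 2 ^ N * √(∑ i with l ∈ S i, a i ^ 2)
      ≤ 3 ^ d * ∑ A ∈ (Finset.range N).powerset, |chaosDeriv S a l (signOf A)| := by
    intro l
    have := sqrt_sum_sq_le_sum_abs_chaosPoly (S := fun i : {i // l ∈ S i} => (S i.1).erase l)
      (fun i j hij => Subtype.ext (hS ?_)) (N := N) (r := d)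
      (fun i => (Finset.erase_subset _ _).trans (hN _))
      (fun i => (Finset.card_erase_le).trans (hd _).le) (fun i => a i.1)
    · rwa [← Finset.sum_subtype_eq_sum_filter, Finset.subtype_univ]
    · rw [← Finset.insert_erase i.2, ← Finset.insert_erase j.2]
      exact congrArg _ hij
  have : 2 ^ N * incidenceNorm S a N ≤ 2 ^ N * (3 ^ d * (C * 2 ^ d) * K) := by
    calc 2 ^ N * incidenceNorm S a N
        ≤ ∑ l ∈ Finset.range N,
          3 ^ d * ∑ A ∈ (Finset.range N).powerset, |chaosDeriv S a l (signOf A)| := by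
          rw [incidenceNorm, Finset.mul_sum]
          exact Finset.sum_le_sum fun l _ => hkh l
      _ = 3 ^ d * ∑ A ∈ (Finset.range N).powerset,
            ∑ l ∈ Finset.range N, |chaosDeriv S a l (signOf A)| := by
          rw [← Finset.mul_sum, Finset.sum_comm]
      _ ≤ 3 ^ d * ∑ A ∈ (Finset.range N).powerset, C * 2 ^ d * K := by
          gcongr with A
          exact hderiv _ (abs_signOf A)
      _ = _ := by
          rw [Finset.sum_const, Finset.card_powerset, Finset.card_range, nsmul_eq_mul]
          push_cast
          ring
  exact le_of_mul_le_mul_left this (by positivity)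

/-- The supremum over signs of a chaos is controlled by the supremum over `{0, 1}`-vectors. -/
theorem exists_abs_chaosPoly_le_of_indicator (d : ℕ) :
    ∃ C : ℝ, 0 < C ∧ ∀ {ι : Type} [Fintype ι] (S : ι → Finset ℕ) (a : ι → ℝ) (K : ℝ),
      (∀ i, (S i).card ≤ d) →
      (∀ x : ℕ → ℝ, (∀ m, x m = 0 ∨ x m = 1) → |chaosPoly S a x| ≤ K) →
      ∀ ε : ℕ → ℝ, (∀ m, |ε m| = 1) → |chaosPoly S a ε| ≤ C * K := by
  obtain ⟨C, hC, h⟩ := exists_abs_le_of_natDegree_le d (Polynomial.leval (-1 : ℝ))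
  refine ⟨C, hC, fun S a K hd hK ε hε => ?_⟩
  -- Here `ε = u - v`, while `u + t v` stays in the cube `[0,1]^N` for `0 ≤ t ≤ 1`; hence the
  -- evaluation at `-1`.
  set u : ℕ → ℝ := fun m => if ε m = 1 then 1 else 0 with hu
  set v : ℕ → ℝ := fun m => if ε m = 1 then 0 else 1 with hv
  have e : chaosPoly S a ε = Polynomial.leval (-1 : ℝ) (linePoly S a u v) := by
    rw [Polynomial.leval_apply, eval_linePoly]
    congr 1
    funext m
    rcases eq_or_eq_neg_of_abs_eq (hε m) with h | h <;> norm_num [hu, hv, h]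
  rw [e]
  refine h _ _ (natDegree_linePoly_le hd _ _) fun t ht0 ht1 => ?_
  rw [eval_linePoly]
  refine abs_chaosPoly_le_of_mem_Icc zero_lt_one hK fun m => ?_
  by_cases h : ε m = 1 <;> simp [hu, hv, h, ht0, ht1]

/-! ### Sign averages: contraction, symmetrization, decoupled chaos -/

theorem le_ciSup_of_finite {T : Type} [Finite T] (f : T → ℝ) (t : T) : f t ≤ ⨆ t, f t :=
  le_ciSup (Set.finite_range f).bddAbove t

/-- Exchange of two families of signs over the fibres of `π` on which `δ = -1`. -/
def swapSigns {ι κ : Type} (π : ι → κ) (δ : κ → ℤˣ) (x : (ι → ℤˣ) × (ι → ℤˣ)) : (ι → ℤˣ) × (ι → ℤˣ) :=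
  (fun i => if δ (π i) = 1 then x.1 i else x.2 i, fun i => if δ (π i) = 1 then x.2 i else x.1 i)

theorem swapSigns_involutive {ι κ : Type} (π : ι → κ) (δ : κ → ℤˣ) :
    Function.Involutive (swapSigns π δ) := by
  rintro ⟨x, y⟩
  ext i <;> by_cases h : δ (π i) = 1 <;> simp [swapSigns, h]

section SignAverages

variable {ι κ T : Type} [Fintype ι] [DecidableEq ι] [Fintype κ] [DecidableEq κ] [Finite T]
  [Nonempty T]

theorem expect_signs_mul (c : ι → ℤˣ) (F : (ι → ℤˣ) → ℝ) : 𝔼 θ, F (θ * c) = 𝔼 θ, F θ :=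
  Fintype.expect_equiv (Equiv.mulRight c) _ _ fun _ => rfl

theorem expect_sign_mul_sign (i j : ι) :
    𝔼 θ : ι → ℤˣ, (((θ i : ℤ) : ℝ) * ((θ j : ℤ) : ℝ)) = if i = j then 1 else 0 := by
  split_ifs with h
  · subst h
    have : ∀ θ : ι → ℤˣ, (((θ i : ℤ) : ℝ) * ((θ i : ℤ) : ℝ)) = 1 := fun θ => by
      rcases Int.units_eq_one_or (θ i) with h | h <;> simp [h]
    simp [this]
  · have := expect_signs_mul (Pi.mulSingle i (-1))
      (fun θ : ι → ℤˣ => ((θ i : ℤ) : ℝ) * ((θ j : ℤ) : ℝ))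
    simp only [Pi.mul_apply, Pi.mulSingle_eq_same, Pi.mulSingle_eq_of_ne' h, mul_neg, mul_one,
      Units.val_neg, Int.cast_neg, neg_mul, Finset.expect_neg_distrib] at this
    linarith

theorem expect_sq_sum_sign (s : Finset ι) (c : ι → ℝ) :
    𝔼 θ : ι → ℤˣ, (∑ i ∈ s, ((θ i : ℤ) : ℝ) * c i) ^ 2 = ∑ i ∈ s, c i ^ 2 := by
  have h : ∀ θ : ι → ℤˣ, (∑ i ∈ s, ((θ i : ℤ) : ℝ) * c i) ^ 2
      = ∑ i ∈ s, ∑ j ∈ s, (((θ i : ℤ) : ℝ) * ((θ j : ℤ) : ℝ)) * (c i * c j) := fun θ => by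
    rw [sq, Finset.sum_mul_sum]
    exact Finset.sum_congr rfl fun i _ => Finset.sum_congr rfl fun j _ => by ring
  simp_rw [h, Finset.expect_sum_comm, ← Finset.expect_mul, expect_sign_mul_sign]
  refine Finset.sum_congr rfl fun i hi => ?_
  simp [hi, sq]

theorem expect_abs_sum_sign_le (s : Finset ι) (c : ι → ℝ) :
    𝔼 θ : ι → ℤˣ, |∑ i ∈ s, ((θ i : ℤ) : ℝ) * c i| ≤ √(∑ i ∈ s, c i ^ 2) := by
  rw [← expect_sq_sum_sign s c]
  refine Real.le_sqrt_of_sq_le ?_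
  have := Finset.expect_mul_sq_le_sq_mul_sq Finset.univ
    (fun θ : ι → ℤˣ => |∑ i ∈ s, ((θ i : ℤ) : ℝ) * c i|) (fun _ => 1)
  simpa using this

theorem sign_mul_abs_sub_le (u : ℤˣ) (x y : ℝ) :
    ((u : ℤ) : ℝ) * |x| - ((u : ℤ) : ℝ) * |y| ≤ |x - y| := by
  rcases Int.units_eq_one_or u with h | h <;> simp only [h]
  · simpa using abs_sub_abs_le_abs_sub x y
  · have := abs_sub_abs_le_abs_sub y x
    rw [abs_sub_comm y x] at this
    push_cast
    linarith

/-- The contraction principle for the absolute value. -/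
theorem expect_iSup_sum_sign_mul_abs_le (X : κ → T → ℝ) :
    𝔼 δ : κ → ℤˣ, ⨆ t, ∑ l, ((δ l : ℤ) : ℝ) * |X l t|
      ≤ 𝔼 δ : κ → ℤˣ, ⨆ t, ∑ l, ((δ l : ℤ) : ℝ) * X l t := by
  -- The absolute values are introduced one index at a time.
  suffices h : ∀ s : Finset κ,
      𝔼 δ : κ → ℤˣ, ⨆ t, ∑ l, ((δ l : ℤ) : ℝ) * (if l ∈ s then |X l t| else X l t)
        ≤ 𝔼 δ : κ → ℤˣ, ⨆ t, ∑ l, ((δ l : ℤ) : ℝ) * X l t by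
    simpa using h Finset.univ
  intro s
  induction s using Finset.induction_on with
  | empty => simp
  | insert m s hm ih =>
    refine le_trans ?_ ih
    set Y : κ → T → ℝ := fun l t => if l ∈ s then |X l t| else X l t with hY
    set Z : κ → T → ℝ := fun l t => if l ∈ insert m s then |X l t| else X l t with hZ
    set c : κ → ℤˣ := Pi.mulSingle m (-1) with hc
    set G : (κ → ℤˣ) → ℝ := fun δ => ⨆ t, ∑ l, ((δ l : ℤ) : ℝ) * Y l t with hG
    set F : (κ → ℤˣ) → ℝ := fun δ => ⨆ t, ∑ l, ((δ l : ℤ) : ℝ) * Z l t with hF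
    change 𝔼 δ, F δ ≤ 𝔼 δ, G δ
    have hYZ : ∀ l ∈ Finset.univ.erase m, ∀ t, Z l t = Y l t := fun l hl t => by
      simp [hY, hZ, Finset.ne_of_mem_erase hl]
    have hYm : ∀ t, Y m t = X m t := fun t => by simp [hY, hm]
    have hZm : ∀ t, Z m t = |X m t| := fun t => by simp [hZ]
    have hcl : ∀ (δ : κ → ℤˣ), ∀ l ∈ Finset.univ.erase m, (δ * c) l = δ l := fun δ l hl => by
      simp [hc, Finset.ne_of_mem_erase hl]
    have hcm : ∀ (δ : κ → ℤˣ), (((δ * c) m : ℤ) : ℝ) = -((δ m : ℤ) : ℝ) := fun δ => by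
      simp [hc]
    -- Pair `δ` with its flip at `m`. For maximizers `t`, `t'` of the two left suprema, `|X m t| -
    -- |X m t'|` is at most `|X m t - X m t'|`; its sign decides which of `t`, `t'` to test in each
    -- right supremum.
    have key : ∀ δ, F δ + F (δ * c) ≤ G δ + G (δ * c) := by
      intro δ
      obtain ⟨t, ht⟩ := exists_eq_ciSup_of_finite (f := fun t => ∑ l, ((δ l : ℤ) : ℝ) * Z l t)
      obtain ⟨t', ht'⟩ :=
        exists_eq_ciSup_of_finite (f := fun t => ∑ l, (((δ * c) l : ℤ) : ℝ) * Z l t)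
      have g1 := fun t => le_ciSup_of_finite (fun t => ∑ l, ((δ l : ℤ) : ℝ) * Y l t) t
      have g2 := fun t => le_ciSup_of_finite (fun t => ∑ l, (((δ * c) l : ℤ) : ℝ) * Y l t) t
      simp only [hF, hG]
      rw [← ht, ← ht']
      have split : ∀ W : κ → ℝ, ∑ l, W l = W m + ∑ l ∈ Finset.univ.erase m, W l := fun W =>
        (Finset.add_sum_erase _ _ (Finset.mem_univ m)).symm
      have eZ : ∀ t, ∑ l ∈ Finset.univ.erase m, ((δ l : ℤ) : ℝ) * Z l t
          = ∑ l ∈ Finset.univ.erase m, ((δ l : ℤ) : ℝ) * Y l t := fun t =>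
        Finset.sum_congr rfl fun l hl => by rw [hYZ l hl]
      have eZ' : ∀ t, ∑ l ∈ Finset.univ.erase m, (((δ * c) l : ℤ) : ℝ) * Z l t
          = ∑ l ∈ Finset.univ.erase m, ((δ l : ℤ) : ℝ) * Y l t := fun t =>
        Finset.sum_congr rfl fun l hl => by rw [hYZ l hl, hcl δ l hl]
      have eY' : ∀ t, ∑ l ∈ Finset.univ.erase m, (((δ * c) l : ℤ) : ℝ) * Y l t
          = ∑ l ∈ Finset.univ.erase m, ((δ l : ℤ) : ℝ) * Y l t := fun t =>
        Finset.sum_congr rfl fun l hl => by rw [hcl δ l hl]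
      have a1 := g1 t
      have a2 := g1 t'
      have b1 := g2 t
      have b2 := g2 t'
      simp only [split _, eZ, eZ', eY', hYm, hZm, hcm] at a1 a2 b1 b2 ⊢
      have hs := sign_mul_abs_sub_le (δ m) (X m t) (X m t')
      rcases Int.units_eq_one_or (δ m) with h | h <;> rcases abs_cases (X m t - X m t') with k | k <;>
        simp only [h, Units.val_one, Units.val_neg, Int.cast_one, Int.cast_neg] at * <;> linarith
    have e1 := expect_signs_mul c F
    have e2 := expect_signs_mul c G
    have := Finset.expect_le_expect (s := Finset.univ) (fun δ _ => key δ)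
    rw [Finset.expect_add_distrib, Finset.expect_add_distrib, e1, e2] at this
    linarith

/-- Symmetrization: a supremum of sums of absolute values of sign sums over the fibres of `π`. -/
theorem expect_iSup_sum_abs_fiber_le (π : ι → κ) (b : ι → T → ℝ) (M : κ → ℝ)
    (hM : ∀ l t, √(∑ i with π i = l, b i t ^ 2) ≤ M l) :
    𝔼 θ : ι → ℤˣ, ⨆ t, ∑ l, |∑ i with π i = l, ((θ i : ℤ) : ℝ) * b i t|
      ≤ ∑ l, M l + 2 * 𝔼 θ : ι → ℤˣ, ⨆ t, ∑ i, ((θ i : ℤ) : ℝ) * b i t := by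
  set X : κ → (ι → ℤˣ) → T → ℝ := fun l θ t => ∑ i with π i = l, ((θ i : ℤ) : ℝ) * b i t with hX
  set D : (κ → ℤˣ) → (ι → ℤˣ) → (ι → ℤˣ) → ℝ := fun δ θ θ' =>
    ⨆ t, ∑ l, ((δ l : ℤ) : ℝ) * (|X l θ t| - |X l θ' t|) with hD
  set R : (κ → ℤˣ) → (ι → ℤˣ) → ℝ := fun δ θ => ⨆ t, ∑ l, ((δ l : ℤ) : ℝ) * |X l θ t| with hR
  have hm : ∀ l t, 𝔼 θ, |X l θ t| ≤ M l := fun l t =>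
    (expect_abs_sum_sign_le _ _).trans (hM l t)
  -- Centre by the mean of an independent copy `θ'`, which is at most `M`, and pull the average out
  -- of the supremum.
  have h1 : ∀ θ, ⨆ t, ∑ l, |X l θ t| ≤ ∑ l, M l + 𝔼 θ', D 1 θ θ' := by
    intro θ
    refine ciSup_le fun t => ?_
    have : ∑ l, |X l θ t| - ∑ l, M l ≤ 𝔼 θ', D 1 θ θ' := by
      calc ∑ l, |X l θ t| - ∑ l, M l ≤ ∑ l, |X l θ t| - ∑ l, 𝔼 θ', |X l θ' t| := by
            gcongr with l; exact hm l t
        _ = 𝔼 θ', ∑ l, (|X l θ t| - |X l θ' t|) := by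
            simp_rw [Finset.expect_sum_comm, Finset.expect_sub_distrib, Finset.sum_sub_distrib]
            simp
        _ ≤ 𝔼 θ', D 1 θ θ' := by
            refine Finset.expect_le_expect fun θ' _ => ?_
            refine le_trans (le_of_eq ?_) (le_ciSup_of_finite _ t)
            simp
    linarith
  -- Exchanging `θ` and `θ'` on the fibres with `δ = -1` preserves the joint average and flips
  -- exactly those terms.
  have h2 : ∀ δ, 𝔼 θ, 𝔼 θ', D 1 θ θ' = 𝔼 θ, 𝔼 θ', D δ θ θ' := by
    intro δ
    rw [← Finset.expect_product', ← Finset.expect_product', Finset.univ_product_univ]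
    refine Fintype.expect_equiv (swapSigns_involutive π δ).toPerm _ _ fun x => ?_
    simp only [hD, Function.Involutive.coe_toPerm]
    congr 1
    funext t
    refine Finset.sum_congr rfl fun l _ => ?_
    rcases Int.units_eq_one_or (δ l) with h | h
    · have e1 : X l (swapSigns π δ x).1 t = X l x.1 t := Finset.sum_congr rfl fun i hi => by
        simp [swapSigns, (Finset.mem_filter.1 hi).2, h]
      have e2 : X l (swapSigns π δ x).2 t = X l x.2 t := Finset.sum_congr rfl fun i hi => by
        simp [swapSigns, (Finset.mem_filter.1 hi).2, h]
      rw [e1, e2, h, Pi.one_apply]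
    · have e1 : X l (swapSigns π δ x).1 t = X l x.2 t := Finset.sum_congr rfl fun i hi => by
        simp [swapSigns, (Finset.mem_filter.1 hi).2, h]
      have e2 : X l (swapSigns π δ x).2 t = X l x.1 t := Finset.sum_congr rfl fun i hi => by
        simp [swapSigns, (Finset.mem_filter.1 hi).2, h]
      rw [e1, e2, h, Pi.one_apply]
      simp
  have h3 : ∀ δ θ θ', D δ θ θ' ≤ R δ θ + R (-δ) θ' := by
    intro δ θ θ'
    refine ciSup_le fun t => ?_
    refine le_trans (le_of_eq ?_)
      (add_le_add (le_ciSup_of_finite _ t) (le_ciSup_of_finite _ t))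
    rw [← Finset.sum_add_distrib]
    refine Finset.sum_congr rfl fun l _ => ?_
    simp only [Pi.neg_apply, Units.val_neg, Int.cast_neg]
    ring
  have h4 : 𝔼 θ, 𝔼 θ', D 1 θ θ' ≤ 2 * 𝔼 δ, 𝔼 θ, R δ θ := by
    calc 𝔼 θ, 𝔼 θ', D 1 θ θ' = 𝔼 _δ : κ → ℤˣ, 𝔼 θ, 𝔼 θ', D 1 θ θ' :=
          (Fintype.expect_const _).symm
      _ = 𝔼 δ : κ → ℤˣ, 𝔼 θ, 𝔼 θ', D δ θ θ' := Finset.expect_congr rfl fun δ _ => h2 δ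
      _ ≤ 𝔼 δ : κ → ℤˣ, 𝔼 θ, 𝔼 θ', (R δ θ + R (-δ) θ') := by
          gcongr with δ _ θ _ θ' _
          exact h3 δ θ θ'
      _ = 𝔼 δ, 𝔼 θ, R δ θ + 𝔼 δ, 𝔼 θ, R (-δ) θ := by
          simp_rw [Finset.expect_add_distrib, Fintype.expect_const]
      _ = _ := by
          have : 𝔼 δ, 𝔼 θ, R (-δ) θ = 𝔼 δ, 𝔼 θ, R δ θ :=
            Fintype.expect_equiv (Equiv.neg _) _ _ fun δ => rfl
          rw [this, two_mul]
  -- Contraction removes the absolute values; then `δ (π i) * θ i` is distributed as `θ i`, so `δ`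
  -- disappears.
  have h5 : 𝔼 δ, 𝔼 θ, R δ θ ≤ 𝔼 θ : ι → ℤˣ, ⨆ t, ∑ i, ((θ i : ℤ) : ℝ) * b i t := by
    calc 𝔼 δ, 𝔼 θ, R δ θ = 𝔼 θ, 𝔼 δ, R δ θ := Finset.expect_comm _ _ _
      _ ≤ 𝔼 θ, 𝔼 δ : κ → ℤˣ, ⨆ t, ∑ l, ((δ l : ℤ) : ℝ) * X l θ t := by
          exact Finset.expect_le_expect fun θ _ => expect_iSup_sum_sign_mul_abs_le fun l t => X l θ t
      _ = 𝔼 δ : κ → ℤˣ, 𝔼 θ, ⨆ t, ∑ l, ((δ l : ℤ) : ℝ) * X l θ t := Finset.expect_comm _ _ _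
      _ = 𝔼 _δ : κ → ℤˣ, 𝔼 θ : ι → ℤˣ, ⨆ t, ∑ i, ((θ i : ℤ) : ℝ) * b i t := by
          refine Finset.expect_congr rfl fun δ _ => ?_
          rw [← expect_signs_mul (fun i => δ (π i))]
          refine Finset.expect_congr rfl fun θ _ => ?_
          congr 1
          funext t
          simp only [hX, Finset.mul_sum]
          rw [← Finset.sum_fiberwise (s := Finset.univ) (g := π)]
          refine Finset.sum_congr rfl fun l _ => Finset.sum_congr rfl fun i hi => ?_
          rw [Pi.mul_apply, (Finset.mem_filter.1 hi).2]
          rcases Int.units_eq_one_or (δ l) with h | h <;> simp [h]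
      _ = _ := Fintype.expect_const _
  calc _ ≤ 𝔼 θ, (∑ l, M l + 𝔼 θ', D 1 θ θ') := Finset.expect_le_expect fun θ _ => h1 θ
    _ = ∑ l, M l + 𝔼 θ, 𝔼 θ', D 1 θ θ' := by
      rw [Finset.expect_add_distrib, Fintype.expect_const]
    _ ≤ _ := by linarith

/-- The mean of the supremum norm of a decoupled chaos with random signs is controlled by mixed
norms of its coefficients. -/
theorem expect_iSup_decoupled_le (a : ι → ℝ) (d : ℕ) (p : ι → Fin d → κ) :
    𝔼 θ : ι → ℤˣ, ⨆ ε : Fin d → κ → ℤˣ, ∑ i, ((θ i : ℤ) : ℝ) * (a i * ∏ k, ((ε k (p i k) : ℤ) : ℝ))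
      ≤ 2 ^ d * ∑ k, ∑ l, √(∑ i with p i k = l, a i ^ 2) := by
  induction d with
  | zero =>
    have : ∀ i : ι, 𝔼 θ : ι → ℤˣ, (((θ i : ℤ) : ℝ) * a i) = 0 := fun i => by
      have := expect_signs_mul (Pi.mulSingle i (-1)) (fun θ : ι → ℤˣ => ((θ i : ℤ) : ℝ) * a i)
      simp only [Pi.mul_apply, Pi.mulSingle_eq_same, mul_neg, mul_one,
        Units.val_neg, Int.cast_neg, neg_mul, Finset.expect_neg_distrib] at this
      linarith
    simp [Finset.expect_sum_comm, this]
  | succ d ih =>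
    set q : ι → Fin d → κ := fun i k => p i k.castSucc with hq
    set b : ι → (Fin d → κ → ℤˣ) → ℝ := fun i ε => a i * ∏ k, ((ε k (q i k) : ℤ) : ℝ) with hb
    -- The square functions of the fibres do not depend on `ε`, which supplies the uniform bound
    -- `M`.
    have hb2 : ∀ i ε, b i ε ^ 2 = a i ^ 2 := fun i ε => by
      have : ∀ k, ((ε k (q i k) : ℤ) : ℝ) ^ 2 = 1 := fun k => by
        rcases Int.units_eq_one_or (ε k (q i k)) with h | h <;> simp [h]
      simp only [hb, mul_pow, ← Finset.prod_pow, this, Finset.prod_const_one, mul_one]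
    have h1 := expect_iSup_sum_abs_fiber_le (fun i => p i (Fin.last d)) b
      (fun l => √(∑ i with p i (Fin.last d) = l, a i ^ 2)) (fun l ε => by simp only [hb2]; rfl)
    have h2 := ih q
    have h3 : 𝔼 θ : ι → ℤˣ, ⨆ ε : Fin (d + 1) → κ → ℤˣ,
          ∑ i, ((θ i : ℤ) : ℝ) * (a i * ∏ k, ((ε k (p i k) : ℤ) : ℝ))
        -- On each fibre the last sign family is a common factor, so its maximum produces absolute
        -- values.
        ≤ 𝔼 θ : ι → ℤˣ, ⨆ ε, ∑ l, |∑ i with p i (Fin.last d) = l, ((θ i : ℤ) : ℝ) * b i ε| := by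
      refine Finset.expect_le_expect fun θ _ => ciSup_le fun ε => ?_
      refine le_trans ?_ (le_ciSup_of_finite _ fun k => ε k.castSucc)
      rw [← Finset.sum_fiberwise (s := Finset.univ) (g := fun i => p i (Fin.last d))]
      refine Finset.sum_le_sum fun l _ => ?_
      have : ∑ i with p i (Fin.last d) = l, ((θ i : ℤ) : ℝ) * (a i * ∏ k, ((ε k (p i k) : ℤ) : ℝ))
          = ((ε (Fin.last d) l : ℤ) : ℝ) * ∑ i with p i (Fin.last d) = l,
            ((θ i : ℤ) : ℝ) * b i fun k => ε k.castSucc := by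
        rw [Finset.mul_sum]
        refine Finset.sum_congr rfl fun i hi => ?_
        rw [Fin.prod_univ_castSucc, (Finset.mem_filter.1 hi).2]
        simp only [hb, hq]
        ring
      rw [this]
      rcases Int.units_eq_one_or (ε (Fin.last d) l) with h | h <;> rw [h]
      · simpa using le_abs_self _
      · simpa using neg_le_abs _
    have hk : 0 ≤ ∑ l, √(∑ i with p i (Fin.last d) = l, a i ^ 2) :=
      Finset.sum_nonneg fun _ _ => Real.sqrt_nonneg _
    have h2d : (1 : ℝ) ≤ 2 ^ (d + 1) := one_le_pow₀ (by norm_num)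
    rw [Fin.sum_univ_castSucc]
    calc _ ≤ _ := h3
      _ ≤ _ := h1
      _ ≤ ∑ l, √(∑ i with p i (Fin.last d) = l, a i ^ 2)
          + 2 * (2 ^ d * ∑ k, ∑ l, √(∑ i with q i k = l, a i ^ 2)) := by gcongr
      _ ≤ 2 ^ (d + 1) * ∑ l, √(∑ i with p i (Fin.last d) = l, a i ^ 2)
          + 2 ^ (d + 1) * ∑ k, ∑ l, √(∑ i with q i k = l, a i ^ 2) := by
        rw [pow_succ', mul_assoc]
        gcongr ?_ + ?_
        · rw [← mul_assoc, ← pow_succ']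
          exact le_mul_of_one_le_left hk h2d
        · rw [mul_assoc]
      _ = _ := by rw [add_comm, mul_add]

end SignAverages

/-! ### Chaos indexed by increasing tuples -/

/-- The polynomial `∑ i, a i * x (j i 1) ⋯ x (j i d)`. -/
def tuplePoly {ι : Type} [Fintype ι] {d : ℕ} (j : ι → Fin d → ℕ) (a : ι → ℝ) (x : ℕ → ℝ) : ℝ :=
  ∑ i, a i * ∏ k, x (j i k)

/-- The set of entries of a tuple. -/
def entries {d : ℕ} (j : Fin d → ℕ) : Finset ℕ := Finset.univ.image j

theorem mem_entries {d : ℕ} {j : Fin d → ℕ} {l : ℕ} : l ∈ entries j ↔ ∃ k, j k = l := by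
  simp [entries]

theorem card_entries {d : ℕ} {j : Fin d → ℕ} (hj : StrictMono j) : (entries j).card = d := by
  rw [entries, Finset.card_image_of_injective _ hj.injective, Finset.card_univ, Fintype.card_fin]

theorem prod_entries {d : ℕ} {j : Fin d → ℕ} (hj : StrictMono j) (x : ℕ → ℝ) :
    ∏ m ∈ entries j, x m = ∏ k, x (j k) :=
  Finset.prod_image hj.injective.injOn

theorem entries_injOn {d : ℕ} {i j : Fin d → ℕ} (hi : StrictMono i) (hj : StrictMono j)
    (h : entries i = entries j) : i = j := by
  refine hi.range_inj hj |>.1 ?_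
  ext l
  simpa [mem_entries] using Finset.ext_iff.1 h l

theorem chaosPoly_entries {ι : Type} [Fintype ι] {d : ℕ} {j : ι → Fin d → ℕ}
    (hj : ∀ i, StrictMono (j i)) (a : ι → ℝ) (x : ℕ → ℝ) :
    chaosPoly (fun i => entries (j i)) a x = tuplePoly j a x :=
  Finset.sum_congr rfl fun i _ => by rw [prod_entries (hj i)]

theorem abs_tuplePoly_le_of_abs_le_one {ι : Type} [Fintype ι] {d : ℕ} {j : ι → Fin d → ℕ}
    (hj : ∀ i, StrictMono (j i)) {a : ι → ℝ} {K : ℝ}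
    (hK : ∀ ε : ℕ → ℝ, (∀ m, |ε m| = 1) → |tuplePoly j a ε| ≤ K)
    {x : ℕ → ℝ} (hx : ∀ m, |x m| ≤ 1) : |tuplePoly j a x| ≤ K := by
  simp only [← chaosPoly_entries hj] at hK ⊢
  exact abs_chaosPoly_le_of_abs_le_one hK hx

/-- The decoupled supremum contains the diagonal choice of equal sign families, so no decoupling
inequality is needed. The functional `F` is abstract to serve both the `L_∞` norm and the modified
cut norm. -/
theorem signMean_le_sum_mixedNorms {ι : Type} [Fintype ι] [DecidableEq ι] {d N : ℕ} (hd : 1 ≤ d)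
    {j : ι → Fin d → ℕ} (hN : ∀ i k, j i k < N) {F : (ι → ℝ) → ℝ}
    (hF : ∀ b K, (∀ ε : ℕ → ℝ, (∀ m, |ε m| = 1) → |tuplePoly j b ε| ≤ K) → F b ≤ K)
    (a : ι → ℝ) :
    signMean F a ≤ 2 ^ d * ∑ k, ∑ l ∈ Finset.range N, √(∑ i with j i k = l, a i ^ 2) := by
  have h := expect_iSup_decoupled_le a d (fun i k => (⟨j i k, hN i k⟩ : Fin N))
  simp only [Fin.ext_iff] at h
  rw [signMean]
  refine (Finset.expect_le_expect fun θ _ => hF _ _ fun ε hε => ?_).trans (h.trans_eq ?_)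
  · set Y := tuplePoly j (fun i => ((θ i : ℤ) : ℝ) * a i) ε with hY
    have hu : ∀ m, ∃ u : ℤˣ, ((u : ℤ) : ℝ) = ε m := fun m => by
      rcases eq_or_eq_neg_of_abs_eq (hε m) with h | h
      exacts [⟨1, by simp [h]⟩, ⟨-1, by simp [h]⟩]
    choose u hu using hu
    -- Multiplying the first family by `s` changes the sign of the whole sum, so both `Y` and `-Y`
    -- are dominated; this needs `1 ≤ d`.
    have hs : ∀ s : ℤˣ, ((s : ℤ) : ℝ) * Y ≤ ⨆ ε : Fin d → Fin N → ℤˣ,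
        ∑ i, ((θ i : ℤ) : ℝ) * (a i * ∏ k, ((ε k ⟨j i k, hN i k⟩ : ℤ) : ℝ)) := by
      intro s
      refine le_trans (le_of_eq ?_)
        (le_ciSup_of_finite _ fun (k : Fin d) (m : Fin N) =>
          (if k = ⟨0, hd⟩ then s else 1) * u m)
      rw [hY, tuplePoly, Finset.mul_sum]
      refine Finset.sum_congr rfl fun i _ => ?_
      simp only [Units.val_mul, Int.cast_mul, hu, Finset.prod_mul_distrib]
      have : ∏ k : Fin d, (((if k = ⟨0, hd⟩ then s else 1 : ℤˣ) : ℤ) : ℝ) = ((s : ℤ) : ℝ) := by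
        rw [Finset.prod_eq_single ⟨0, hd⟩] <;> simp +contextual
      rw [this]
      ring
    rw [abs_le']
    exact ⟨by simpa using hs 1, by simpa using hs (-1)⟩
  · congr 1
    refine Finset.sum_congr rfl fun k _ => ?_
    rw [Finset.sum_range]

/-! ### The norm in `L_∞[0,1]` as a maximum over signs -/

/-- Every sign pattern of the first `n` Rademacher functions is attained on a dyadic interval. -/
theorem exists_dyadic_rademacher_eq (n : ℕ) (ε : ℕ → ℝ) (hε : ∀ m, |ε m| = 1) :
    ∃ q : ℕ, q < 2 ^ n ∧ ∀ t : ℝ, (q : ℝ) ≤ 2 ^ n * t → 2 ^ n * t < q + 1 →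
      ∀ i, 1 ≤ i → i ≤ n → rademacher i t = ε i := by
  induction n with
  | zero => exact ⟨0, by simp, fun t _ _ i h1 h2 => by omega⟩
  | succ n ih =>
    obtain ⟨q, hq, h⟩ := ih
    obtain ⟨b, hb, hbε⟩ : ∃ b : ℕ, b < 2 ∧ ε (n + 1) = (-1) ^ b := by
      rcases eq_or_eq_neg_of_abs_eq (hε (n + 1)) with h | h
      exacts [⟨0, by simp, by simp [h]⟩, ⟨1, by simp, by simp [h]⟩]
    -- Appending the binary digit `b` makes the floor of `2 ^ (n + 1) * t` equal to `2 * q + b`,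
    -- whose parity is that of `b`.
    refine ⟨2 * q + b, by rw [pow_succ]; omega, fun t h1 h2 i hi1 hi2 => ?_⟩
    have hb' : (b : ℝ) ≤ 1 := by exact_mod_cast Nat.lt_succ_iff.1 hb
    have hb0 : (0 : ℝ) ≤ b := by positivity
    rcases Nat.lt_or_ge n i with hlt | hle
    · obtain rfl : i = n + 1 := by omega
      have : ⌊(2 : ℝ) ^ (n + 1) * t⌋ = ((2 * q + b : ℕ) : ℤ) :=
        Int.floor_eq_iff.2 ⟨by exact_mod_cast h1, by exact_mod_cast h2⟩
      rw [rademacher, this, zpow_natCast, hbε, pow_add, pow_mul]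
      simp
    · push_cast at h1 h2
      rw [pow_succ] at h1 h2
      exact h t (by linarith) (by linarith) i hi1 hle

section Linfty

variable {ι : Type} [Fintype ι] {d : ℕ} (j : ι → Fin d → ℕ) (a : ι → ℝ)

theorem coeFn_sum_smul_chaosFun :
    (∑ i, a i • chaosFun (j i) : LinftyUnit)
      =ᵐ[volume.restrict (Set.Icc (0 : ℝ) 1)] fun t => tuplePoly j a (fun m => rademacher m t) := by
  have h : ∀ i, (a i • chaosFun (j i) : LinftyUnit)
      =ᵐ[volume.restrict (Set.Icc (0 : ℝ) 1)] fun t => a i * ∏ k, rademacher (j i k) t := fun i => by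
    filter_upwards [Lp.coeFn_smul (a i) (chaosFun (j i)), (memLp_chaos (j i)).coeFn_toLp]
      with t h1 h2
    rw [h1, Pi.smul_apply, chaosFun, h2, smul_eq_mul]
  filter_upwards [Lp.coeFn_fun_finsetSum Finset.univ fun i => (a i • chaosFun (j i) : LinftyUnit),
    ae_all_iff.2 h] with t h1 h2
  rw [h1]
  exact Finset.sum_congr rfl fun i _ => h2 i

theorem norm_sum_smul_chaosFun_le {K : ℝ}
    (hK : ∀ ε : ℕ → ℝ, (∀ m, |ε m| = 1) → |tuplePoly j a ε| ≤ K) :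
    ‖∑ i, a i • chaosFun (j i)‖ ≤ K := by
  have hK0 : 0 ≤ K := (abs_nonneg _).trans (hK 1 (by simp))
  have := Lp.norm_le_of_ae_bound (f := ∑ i, a i • chaosFun (j i)) hK0 (by
    filter_upwards [coeFn_sum_smul_chaosFun j a] with t ht
    rw [ht]
    exact hK _ fun m => abs_rademacher m t)
  simpa using this

theorem abs_tuplePoly_le_norm (hj : ∀ i k, 1 ≤ j i k) (ε : ℕ → ℝ) (hε : ∀ m, |ε m| = 1) :
    |tuplePoly j a ε| ≤ ‖∑ i, a i • chaosFun (j i)‖ := by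
  set f : LinftyUnit := ∑ i, a i • chaosFun (j i) with hf
  obtain ⟨n, hn⟩ : ∃ n, ∀ i k, j i k ≤ n :=
    ⟨∑ i, ∑ k, j i k, fun i k => (Finset.single_le_sum (f := fun k => j i k)
      (fun _ _ => Nat.zero_le _) (Finset.mem_univ k)).trans
      (Finset.single_le_sum (f := fun i => ∑ k, j i k) (fun _ _ => Nat.zero_le _)
        (Finset.mem_univ i))⟩
  obtain ⟨q, hq, h⟩ := exists_dyadic_rademacher_eq n ε hε
  have h2 : (0 : ℝ) < 2 ^ n := by positivity
  set J := Set.Ico ((q : ℝ) / 2 ^ n) ((q + 1) / 2 ^ n) with hJ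
  have hJsub : J ⊆ Set.Icc 0 1 := by
    intro t ht
    refine ⟨le_trans (by positivity) ht.1, ht.2.le.trans ?_⟩
    rw [div_le_one h2]
    exact_mod_cast hq
  have hJpos : (volume.restrict (Set.Icc (0 : ℝ) 1)) J ≠ 0 := by
    rw [Measure.restrict_apply measurableSet_Ico, Set.inter_eq_left.2 hJsub, Real.volume_Ico,
      ← sub_div]
    simp
  have hae : ∀ᵐ t ∂(volume.restrict (Set.Icc (0 : ℝ) 1)), |f t| ≤ ‖f‖ := by
    filter_upwards [ae_le_eLpNormEssSup (f := f)] with t ht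
    rw [Lp.norm_def, eLpNorm_exponent_top, ← Real.norm_eq_abs, ← toReal_enorm]
    exact ENNReal.toReal_mono (by
      rw [← eLpNorm_exponent_top]; exact Lp.eLpNorm_ne_top f) ht
  obtain ⟨t, htJ, ht1, ht2⟩ : ∃ t ∈ J, |f t| ≤ ‖f‖
      ∧ f t = tuplePoly j a (fun m => rademacher m t) := by
    -- The dyadic interval `J` has positive measure, so it meets the set of full measure where both
    -- properties hold.
    by_contra! hcon
    refine hJpos (measure_mono_null ?_ (hae.and (coeFn_sum_smul_chaosFun j a)))
    intro t ht hh
    exact hcon t ht hh.1 hh.2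
  have e : tuplePoly j a (fun m => rademacher m t) = tuplePoly j a ε := by
    refine Finset.sum_congr rfl fun i _ => ?_
    congr 1
    refine Finset.prod_congr rfl fun k _ => ?_
    refine h t ?_ ?_ _ (hj i k) (hn i k)
    · have := htJ.1; rwa [div_le_iff₀' h2] at this
    · have := htJ.2; rwa [lt_div_iff₀' h2] at this
  rw [← e, ← ht2]
  exact ht1

end Linfty

/-! ### A criterion for basic sequences -/

/-- Grünblum's criterion. -/
theorem isBasicSequence_of_norm_sum_le {X : Type*} [NormedAddCommGroup X] [NormedSpace ℝ X]
    {x : ℕ → X} (hx : ∀ k, x k ≠ 0) {K : ℝ}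
    (hK : ∀ (a : ℕ → ℝ) (m n : ℕ), m ≤ n →
      ‖∑ k ∈ Finset.range m, a k • x k‖ ≤ K * ‖∑ k ∈ Finset.range n, a k • x k‖) :
    IsBasicSequence x := by
  have hfin : ∀ (f : ℕ →₀ ℝ) (m : ℕ), ‖∑ k ∈ Finset.range m, f k • x k‖
      ≤ K * ‖Finsupp.linearCombination ℝ x f‖ := by
    intro f m
    obtain ⟨n, hn⟩ := f.support.exists_nat_subset_range
    have : Finsupp.linearCombination ℝ x f = ∑ k ∈ Finset.range (max m n), f k • x k := by
      rw [Finsupp.linearCombination_apply]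
      exact Finsupp.sum_of_support_subset _
        (hn.trans (Finset.range_mono (le_max_right _ _))) _ (by simp)
    rw [this]
    exact hK _ _ _ (le_max_left _ _)
  have hcoef : ∀ (f : ℕ →₀ ℝ) (k : ℕ),
      ‖f k‖ ≤ 2 * K / ‖x k‖ * ‖Finsupp.linearCombination ℝ x f‖ := by
    intro f k
    have hk : 0 < ‖x k‖ := norm_pos_iff.2 (hx k)
    have e : f k • x k
        = ∑ l ∈ Finset.range (k + 1), f l • x l - ∑ l ∈ Finset.range k, f l • x l := by
      rw [Finset.sum_range_succ, add_sub_cancel_left]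
    have := (norm_sub_le _ _).trans (add_le_add (hfin f (k + 1)) (hfin f k))
    rw [← e, norm_smul] at this
    rw [div_mul_eq_mul_div, le_div_iff₀ hk]
    linarith
  have hli : LinearIndependent ℝ x := by
    refine linearIndependent_iff.2 fun f hf => Finsupp.ext fun k => ?_
    have := hcoef f k
    rw [hf, norm_zero, mul_zero] at this
    simpa using this
  set Y := Submodule.span ℝ (Set.range x) with hY
  have hspan : ∀ y : Y, Finsupp.linearCombination ℝ x (hli.repr y) = y := fun y =>
    hli.linearCombination_repr y
  -- The coordinate functionals are bounded on the span by `hcoef`; Hahn–Banach extends them to `X`,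
  -- hence to the closure of the span.
  have hext : ∀ k, ∃ g : StrongDual ℝ X, ∀ y : Y, g y = hli.repr y k := fun k => by
    obtain ⟨g, hg, -⟩ := exists_extension_norm_eq Y
      (LinearMap.mkContinuous ((Finsupp.lapply k).comp hli.repr) (2 * K / ‖x k‖) fun y => by
        have := hcoef (hli.repr y) k
        rwa [hspan] at this)
    exact ⟨g, fun y => by rw [hg]; rfl⟩
  choose g hg using hext
  have hgx : ∀ k l, g k (x l) = (Pi.single l (1 : ℝ) : ℕ → ℝ) k := fun k l => by
    have h1 := hg k ⟨x l, Submodule.subset_span ⟨l, rfl⟩⟩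
    rw [hli.repr_eq_single l ⟨x l, Submodule.subset_span ⟨l, rfl⟩⟩ rfl] at h1
    rw [h1, Finsupp.single_apply, Pi.single_apply]
    simp [eq_comm]
  set P : ℕ → X → X := fun n y => ∑ k ∈ Finset.range n, g k y • x k with hP
  have hPcont : ∀ n, Continuous (P n) := fun n =>
    continuous_finsetSum _ fun k _ => (g k).continuous.smul continuous_const
  have hPle : ∀ n, ∀ y ∈ Y.topologicalClosure, ‖P n y‖ ≤ K * ‖y‖ := by
    intro n y hy
    have hcl : IsClosed {y | ‖P n y‖ ≤ K * ‖y‖} :=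
      isClosed_le (hPcont n).norm (continuous_const.mul continuous_norm)
    refine hcl.closure_subset_iff.2 ?_ (hy : y ∈ closure (Y : Set X))
    intro z hz
    have := hfin (hli.repr ⟨z, hz⟩) n
    rw [hspan] at this
    simp only [← hg] at this
    exact this
  -- The projections are uniformly bounded and eventually fix each vector of the dense span.
  have hPlim : ∀ y ∈ Y.topologicalClosure, Tendsto (fun n => P n y) atTop (𝓝 y) := by
    intro y hy
    rw [Metric.tendsto_atTop]
    intro ε hε
    have hK1 : 0 < |K| + 1 := by positivity
    obtain ⟨z, hz, hyz⟩ := Metric.mem_closure_iff.1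
      (hy : y ∈ closure (Y : Set X)) (ε / (|K| + 1))
      (by positivity)
    obtain ⟨M, hM⟩ := (hli.repr ⟨z, hz⟩).support.exists_nat_subset_range
    refine ⟨M, fun n hn => ?_⟩
    have hPz : P n z = z := by
      have h1 := hspan ⟨z, hz⟩
      rw [Finsupp.linearCombination_apply, Finsupp.sum_of_support_subset _
        (hM.trans (Finset.range_mono hn)) _ (by simp)] at h1
      simp only [← hg] at h1
      exact h1
    have hsub : P n y - y = P n (y - z) - (y - z) := by
      have : P n (y - z) = P n y - P n z := by
        simp only [hP, map_sub, sub_smul, Finset.sum_sub_distrib]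
      rw [this, hPz]
      abel
    rw [dist_eq_norm, hsub]
    have h2 := hPle n (y - z) (Submodule.sub_mem _ hy (Submodule.le_topologicalClosure _ hz))
    rw [dist_eq_norm, lt_div_iff₀ hK1] at hyz
    calc _ ≤ ‖P n (y - z)‖ + ‖y - z‖ := norm_sub_le _ _
      _ ≤ |K| * ‖y - z‖ + ‖y - z‖ := by
        gcongr
        exact h2.trans (by gcongr; exact le_abs_self K)
      _ < ε := by linarith
  refine ⟨⟨fun k => ⟨x k, Submodule.le_topologicalClosure _ (Submodule.subset_span ⟨k, rfl⟩)⟩,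
    fun k => (g k).comp Y.topologicalClosure.subtypeL, fun k l => (hgx k l).trans (by
      simp only [Pi.single_apply]; split_ifs <;> rfl), fun y => ?_⟩,
    fun m => rfl⟩
  rw [HasSum, SummationFilter.conditional_filter_eq_map_range, tendsto_map'_iff,
    tendsto_subtype_rng]
  convert hPlim y y.2 using 2 with n
  simp [hP]

/-! ### The natural order and initial segments -/

theorem chaosLT_or_chaosLT_of_ne {d : ℕ} {i j : Fin d → ℕ} (h : i ≠ j) :
    chaosLT i j ∨ chaosLT j i := by
  obtain ⟨k, hk⟩ := Function.ne_iff.1 h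
  set s : Finset (Fin d) := Finset.univ.filter fun k => i k ≠ j k
  have hs : s.Nonempty := ⟨k, by simp [s, hk]⟩
  have hm : i (s.max' hs) ≠ j (s.max' hs) := (Finset.mem_filter.1 (s.max'_mem hs)).2
  have hl : ∀ l, s.max' hs < l → i l = j l := fun l hl => by
    by_contra hne
    exact absurd (s.le_max' l (by simp [s, hne])) (not_le.2 hl)
  rcases lt_or_gt_of_ne hm with h | h
  · exact Or.inl ⟨_, h, hl⟩
  · exact Or.inr ⟨_, h, fun l hh => (hl l hh).symm⟩

theorem chaosLT_asymm {d : ℕ} {i j : Fin d → ℕ} (h : chaosLT i j) : ¬ chaosLT j i := by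
  rintro ⟨l, hl, hl'⟩
  obtain ⟨k, hk, hk'⟩ := h
  rcases lt_trichotomy k l with h | rfl | h
  · exact hl.ne (hk' l h).symm
  · exact hk.not_gt hl
  · exact hk.ne (hl' k h).symm

/-- The natural order is the order of binary numbers with digits `1` at the entries; the powers up
to place `k` sum to less than `2 ^ j k`. -/
theorem sum_two_pow_lt_of_chaosLT {d : ℕ} {i j : Fin d → ℕ} (hi : StrictMono i)
    (h : chaosLT i j) : ∑ k, 2 ^ i k < ∑ k, 2 ^ j k := by
  obtain ⟨k, hk, hk'⟩ := h
  rw [← Finset.sum_filter_add_sum_filter_not _ (fun l => k < l) (fun l => 2 ^ i l),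
    ← Finset.sum_filter_add_sum_filter_not _ (fun l => k < l) (fun l => 2 ^ j l)]
  refine add_lt_add_of_le_of_lt (Finset.sum_le_sum fun l hl => ?_) ?_
  · rw [hk' l (Finset.mem_filter.1 hl).2]
  · calc ∑ l with ¬ k < l, 2 ^ i l
        = ∑ m ∈ (Finset.univ.filter fun l => ¬ k < l).image i, 2 ^ m :=
          (Finset.sum_image hi.injective.injOn).symm
      _ < 2 ^ j k := Nat.geomSum_lt le_rfl fun m hm => by
          obtain ⟨l, hl, rfl⟩ := Finset.mem_image.1 hm
          exact (hi.monotone (not_lt.1 (Finset.mem_filter.1 hl).2)).trans_lt hk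
      _ ≤ _ := Finset.single_le_sum (f := fun l => 2 ^ j l) (fun _ _ => Nat.zero_le _)
          (by simp)

theorem exists_equiv_chaosIndex {d : ℕ} (hd : 1 ≤ d) :
    ∃ e : ℕ ≃ chaosIndex d, ∀ m m' : ℕ, m < m' → chaosLT (e m).1 (e m').1 := by
  set code : chaosIndex d → ℕ := fun j => ∑ k, 2 ^ j.1 k with hcode
  have hlt : ∀ i j : chaosIndex d, chaosLT i.1 j.1 → code i < code j := fun i j h =>
    sum_two_pow_lt_of_chaosLT i.2.2 h
  have hinj : Function.Injective code := by
    intro i j h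
    by_contra hne
    rcases chaosLT_or_chaosLT_of_ne (fun h => hne (Subtype.ext h)) with h' | h'
    · exact (hlt i j h').ne h
    · exact (hlt j i h').ne' h
  have : Infinite (chaosIndex d) := by
    refine Infinite.of_injective (fun n : ℕ => (⟨fun k => n + k + 1, fun k => Nat.le_add_left _ _,
      fun k l h => by simpa using h⟩ : chaosIndex d)) fun m n h => ?_
    have := congrFun (Subtype.ext_iff.1 h) ⟨0, hd⟩
    simpa using this
  have : Infinite (Set.range code) := (Equiv.ofInjective code hinj).infinite_iff.1 this
  classical
  set o := Nat.Subtype.orderIsoOfNat (Set.range code)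
  set e : ℕ ≃ chaosIndex d := o.toEquiv.trans (Equiv.ofInjective code hinj).symm with he
  have hoe : ∀ m, code (e m) = o m := fun m => by
    rw [he]
    exact congrArg Subtype.val ((Equiv.ofInjective code hinj).apply_symm_apply (o m))
  refine ⟨e, fun m m' h => ?_⟩
  have hc : code (e m) < code (e m') := by
    rw [hoe, hoe]
    exact o.strictMono h
  rcases chaosLT_or_chaosLT_of_ne (i := (e m).1) (j := (e m').1)
    (fun h' => hc.ne (congrArg code (Subtype.ext h'))) with h' | h'
  · exact h'
  · exact absurd (hlt _ _ h') hc.not_gt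

/-- Sums over initial segments of the chaos in its natural order are bounded by the supremum norm
of the whole sum. -/
theorem abs_sum_mul_prod_le_of_initial {d : ℕ} : ∀ {ι : Type} [Fintype ι] {j : ι → Fin d → ℕ},
    (∀ i, StrictMono (j i)) → Function.Injective j → ∀ {a : ι → ℝ} {K : ℝ},
    (∀ ε : ℕ → ℝ, (∀ m, |ε m| = 1) → |tuplePoly j a ε| ≤ K) →
    ∀ T : Finset ι, (∀ i ∈ T, ∀ i', chaosLT (j i') (j i) → i' ∈ T) →
    ∀ ε : ℕ → ℝ, (∀ m, |ε m| = 1) → |∑ i ∈ T, a i * ∏ k, ε (j i k)| ≤ 3 ^ d * K := by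
  induction d with
  | zero =>
    intro ι _ j _ hinj a K hK T _ ε hε
    have hsub : Subsingleton ι := ⟨fun i i' => hinj (Subsingleton.elim _ _)⟩
    have hK0 : 0 ≤ K := (abs_nonneg _).trans (hK ε hε)
    rcases T.eq_empty_or_nonempty with rfl | ⟨i, hi⟩
    · simpa using hK0
    · have : T = Finset.univ := Finset.eq_univ_of_forall fun i' => by
        rwa [Subsingleton.elim i' i]
      simpa [this, tuplePoly] using hK ε hε
  | succ d ih =>
    intro ι _ j hj hinj a K hK T hT ε hε
    classical
    have hK0 : 0 ≤ K := (abs_nonneg _).trans (hK ε hε)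
    rcases T.eq_empty_or_nonempty with rfl | hne
    · simp; positivity
    -- With `N` the largest last entry in `T`, every tuple with smaller last entry lies in `T`.
    obtain ⟨i₀, hi₀, hmax⟩ := T.exists_max_image (fun i => j i (Fin.last d)) hne
    set N := j i₀ (Fin.last d) with hN
    have hle : ∀ i k, j i k ≤ j i (Fin.last d) := fun i k => (hj i).monotone (Fin.le_last k)
    have hlow : ∀ i, j i (Fin.last d) < N → i ∈ T := fun i hi =>
      hT i₀ hi₀ i ⟨Fin.last d, hi, fun l hl => absurd (Fin.le_last l) (not_le.2 hl)⟩
    -- the part of the polynomial in the variables below `N`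
    have hlt : ∀ δ : ℕ → ℝ, (∀ m, |δ m| = 1) →
        |∑ i with j i (Fin.last d) < N, a i * ∏ k, δ (j i k)| ≤ K := by
      intro δ hδ
      have := abs_tuplePoly_le_of_abs_le_one hj hK (x := fun m => if m < N then δ m else 0)
        (fun m => by split_ifs <;> simp [hδ])
      convert this using 2
      rw [tuplePoly, Finset.sum_filter]
      refine Finset.sum_congr rfl fun i _ => ?_
      split_ifs with h
      · congr 1
        exact Finset.prod_congr rfl fun k _ => by rw [if_pos ((hle i k).trans_lt h)]
      · rw [Finset.prod_eq_zero (Finset.mem_univ (Fin.last d)) (if_neg h), mul_zero]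
    set ι' := {i // j i (Fin.last d) = N}
    set j' : ι' → Fin d → ℕ := fun i k => j i.1 k.castSucc with hj'
    have hlt' : ∀ (i : ι') k, j' i k < N := fun i k => by
      have := hj i.1 (Fin.castSucc_lt_last k)
      rwa [i.2] at this
    have hprod : ∀ (i : ι') (δ : ℕ → ℝ), ∏ k, δ (j i.1 k) = (∏ k, δ (j' i k)) * δ N := fun i δ => by
      rw [Fin.prod_univ_castSucc, i.2]
    -- Set the variable `N` to `1` and the later ones to `0`, then subtract the part below `N`: two
    -- terms of size `K`.
    have hblock : ∀ δ : ℕ → ℝ, (∀ m, |δ m| = 1) →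
        |tuplePoly j' (fun i => a i.1) δ| ≤ 2 * K := by
      intro δ hδ
      have h1 := abs_tuplePoly_le_of_abs_le_one hj hK
        (x := fun m => if m < N then δ m else if m = N then 1 else 0)
        (fun m => by split_ifs <;> simp [hδ])
      have h2 := hlt δ hδ
      have e : tuplePoly j a (fun m => if m < N then δ m else if m = N then 1 else 0)
          = ∑ i with j i (Fin.last d) < N, a i * ∏ k, δ (j i k)
            + tuplePoly j' (fun i => a i.1) δ := by
        have e1 : tuplePoly j' (fun i => a i.1) δ = ∑ i with j i (Fin.last d) = N,
            a i * ∏ k : Fin d, δ (j i k.castSucc) := by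
          rw [← Finset.sum_subtype_eq_sum_filter, Finset.subtype_univ]
          rfl
        rw [e1, tuplePoly, Finset.sum_filter, Finset.sum_filter, ← Finset.sum_add_distrib]
        refine Finset.sum_congr rfl fun i _ => ?_
        rcases lt_trichotomy (j i (Fin.last d)) N with h | h | h
        · rw [if_pos h, if_neg h.ne, add_zero]
          congr 1
          exact Finset.prod_congr rfl fun k _ => by rw [if_pos ((hle i k).trans_lt h)]
        · rw [if_neg h.not_lt, if_pos h, zero_add, Fin.prod_univ_castSucc]
          rw [if_neg h.not_lt, if_pos h, mul_one]
          congr 1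
          exact Finset.prod_congr rfl fun k _ => by rw [if_pos (hlt' ⟨i, h⟩ k)]
        · rw [if_neg h.not_gt, if_neg h.ne', Finset.prod_eq_zero (Finset.mem_univ (Fin.last d))
            (by rw [if_neg h.not_gt, if_neg h.ne'])]
          simp
      rw [e] at h1
      calc _ = |(∑ i with j i (Fin.last d) < N, a i * ∏ k, δ (j i k)
            + tuplePoly j' (fun i => a i.1) δ)
            - ∑ i with j i (Fin.last d) < N, a i * ∏ k, δ (j i k)| := by rw [add_sub_cancel_left]
        _ ≤ _ := abs_sub _ _
        _ ≤ 2 * K := by linarith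
    have hinj' : Function.Injective j' := by
      intro i i' h
      refine Subtype.ext (hinj (funext fun k => ?_))
      refine Fin.lastCases ?_ (fun k => congrFun h k) k
      rw [i.2, i'.2]
    have hrec := ih (j := j') (fun i k l h => hj i.1 (by simpa using h)) hinj' hblock
      (T.subtype _) (fun i hi i' h => by
        rw [Finset.mem_subtype] at hi ⊢
        refine hT _ hi _ ?_
        obtain ⟨k, hk, hk'⟩ := h
        refine ⟨k.castSucc, hk, fun l => Fin.lastCases (fun _ => by rw [i.2, i'.2])
          (fun l hl => hk' l (by simpa using hl)) l⟩) ε hε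
    have hdecomp : ∑ i ∈ T, a i * ∏ k, ε (j i k)
        = ∑ i with j i (Fin.last d) < N, a i * ∏ k, ε (j i k)
          + (∑ i ∈ T.subtype (fun i => j i (Fin.last d) = N), a i.1 * ∏ k, ε (j' i k)) * ε N := by
      rw [← Finset.sum_filter_add_sum_filter_not T (fun i => j i (Fin.last d) < N), Finset.sum_mul]
      congr 1
      · refine Finset.sum_congr ?_ fun _ _ => rfl
        ext i
        simpa using hlow i
      · have : T.filter (fun i => ¬ j i (Fin.last d) < N)
            = T.filter (fun i => j i (Fin.last d) = N) :=
          Finset.filter_congr fun i hi => ⟨fun h => le_antisymm (hmax i hi) (not_lt.1 h),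
            fun h => h.not_lt⟩
        rw [this, ← Finset.sum_subtype_eq_sum_filter]
        exact Finset.sum_congr rfl fun i _ => by rw [hprod, mul_assoc]
    rw [hdecomp]
    -- The total is `K + 3 ^ d * (2 * K)`, at most `3 ^ (d + 1) * K`.
    have h3 : (1 : ℝ) ≤ 3 ^ d := one_le_pow₀ (by norm_num)
    refine (abs_add_le _ _).trans ?_
    rw [abs_mul, hε, mul_one]
    have := hlt ε hε
    rw [pow_succ]
    nlinarith

/-! ### Random unconditionality of the chaos -/

theorem exists_forall_lt {ι : Type} [Fintype ι] {d : ℕ} (j : ι → Fin d → ℕ) :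
    ∃ N, ∀ i k, j i k < N := by
  obtain ⟨N, hN⟩ := (Set.finite_range fun p : ι × Fin d => j p.1 p.2).bddAbove
  exact ⟨N + 1, fun i k => Nat.lt_succ_of_le (hN ⟨(i, k), rfl⟩)⟩

theorem sum_sqrt_le_incidenceNorm {ι : Type} [Fintype ι] {d : ℕ} (j : ι → Fin d → ℕ) (a : ι → ℝ)
    (N : ℕ) (k : Fin d) :
    ∑ l ∈ Finset.range N, √(∑ i with j i k = l, a i ^ 2)
      ≤ incidenceNorm (fun i => entries (j i)) a N := by
  refine Finset.sum_le_sum fun l _ => Real.sqrt_le_sqrt ?_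
  refine Finset.sum_le_sum_of_subset_of_nonneg (fun i hi => ?_) fun _ _ _ => sq_nonneg _
  simp only [Finset.mem_filter, Finset.mem_univ, true_and] at hi ⊢
  exact mem_entries.2 ⟨k, hi⟩

theorem exists_incidenceNorm_entries_le (d : ℕ) :
    ∃ C : ℝ, 0 < C ∧ ∀ {ι : Type} [Fintype ι] {j : ι → Fin d → ℕ} (a : ι → ℝ) (N : ℕ) (K : ℝ),
      (∀ i, StrictMono (j i)) → Function.Injective j → (∀ i k, j i k < N) →
      (∀ ε : ℕ → ℝ, (∀ m, |ε m| = 1) → |tuplePoly j a ε| ≤ K) →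
      incidenceNorm (fun i => entries (j i)) a N ≤ C * K := by
  obtain ⟨C, hC, h⟩ := exists_incidenceNorm_le d
  refine ⟨C, hC, fun {ι} _ j a N K hj hinj hN hK => h _ a N K ?_ ?_ ?_ ?_⟩
  · exact fun i i' hi => hinj (entries_injOn (hj i) (hj i') hi)
  · intro i l hl
    obtain ⟨k, rfl⟩ := mem_entries.1 hl
    exact Finset.mem_range.2 (hN i k)
  · exact fun i => card_entries (hj i)
  · simpa only [chaosPoly_entries hj] using hK

/-- Random unconditionality of the chaos: the mean over signs of a functional dominated by the
supremum norm of the chaos is controlled by the supremum norm. -/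
theorem exists_signMean_le {d : ℕ} (hd : 1 ≤ d) :
    ∃ C : ℝ, 0 < C ∧ ∀ {ι : Type} [Fintype ι] [DecidableEq ι] {j : ι → Fin d → ℕ}
      (F : (ι → ℝ) → ℝ) (a : ι → ℝ) (K : ℝ),
      (∀ i, StrictMono (j i)) → Function.Injective j →
      (∀ b K, (∀ ε : ℕ → ℝ, (∀ m, |ε m| = 1) → |tuplePoly j b ε| ≤ K) → F b ≤ K) →
      (∀ ε : ℕ → ℝ, (∀ m, |ε m| = 1) → |tuplePoly j a ε| ≤ K) →
      signMean F a ≤ C * K := by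
  obtain ⟨C, hC, h⟩ := exists_incidenceNorm_entries_le d
  refine ⟨2 ^ d * (d * C), by positivity, fun {ι} _ _ j F a K hj hinj hF hK => ?_⟩
  obtain ⟨N, hN⟩ := exists_forall_lt j
  calc signMean F a
      ≤ 2 ^ d * ∑ k, ∑ l ∈ Finset.range N, √(∑ i with j i k = l, a i ^ 2) :=
        signMean_le_sum_mixedNorms hd hN hF a
    _ ≤ 2 ^ d * ∑ _k : Fin d, C * K := by
        gcongr with k
        exact (sum_sqrt_le_incidenceNorm j a N k).trans (h a N K hj hinj hN hK)
    _ = _ := by simp; ring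

theorem chaosFun_ne_zero {d : ℕ} {j : Fin d → ℕ} (hj : ∀ k, 1 ≤ j k) : chaosFun j ≠ 0 := by
  have := abs_tuplePoly_le_norm (fun _ : Unit => j) (fun _ => 1) (fun _ => hj) 1 (by simp)
  intro h
  norm_num [tuplePoly, h] at this

theorem isBasicSequence_chaosFun {d : ℕ} (e : ℕ ≃ chaosIndex d)
    (he : ∀ m m' : ℕ, m < m' → chaosLT (e m).1 (e m').1) :
    IsBasicSequence fun m => chaosFun (e m).1 := by
  refine isBasicSequence_of_norm_sum_le (fun k => chaosFun_ne_zero (e k).2.1) (K := 3 ^ d) ?_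
  intro a m n hmn
  set j : Fin n → Fin d → ℕ := fun k => (e k).1 with hj
  have hinj : Function.Injective j := fun k k' h => Fin.ext (e.injective (Subtype.ext h))
  rw [Finset.sum_range (n := n) (fun k => a k • chaosFun (e k).1)]
  set T : Finset (Fin n) := Finset.univ.filter fun k => (k : ℕ) < m with hT
  have e1 : ∑ k ∈ Finset.range m, a k • chaosFun (e k).1
      = ∑ k : Fin n, (if k ∈ T then a k else 0) • chaosFun (j k) := by
    simp only [hT, Finset.mem_filter, Finset.mem_univ, true_and, hj]
    rw [← Finset.sum_range (n := n) (fun k => (if k < m then a k else 0) • chaosFun (e k).1)]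
    refine (Finset.sum_congr rfl fun k hk => ?_).trans
      (Finset.sum_subset (Finset.range_mono hmn) fun k _ hk => ?_)
    · rw [if_pos (Finset.mem_range.1 hk)]
    · rw [if_neg (fun h => hk (Finset.mem_range.2 h)), zero_smul]
  rw [e1]
  refine norm_sum_smul_chaosFun_le j _ fun ε hε => ?_
  have e2 : tuplePoly j (fun k => if k ∈ T then a k else 0) ε
      = ∑ k ∈ T, a k * ∏ l, ε (j k l) := by
    simp [tuplePoly, ite_mul]
  rw [e2]
  refine abs_sum_mul_prod_le_of_initial (j := j) (fun k => (e k).2.2) hinj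
    (fun δ hδ => abs_tuplePoly_le_norm j (fun k => a k) (fun k => (e k).2.1) δ hδ) T ?_ ε hε
  intro k hk k' h
  simp only [hT, Finset.mem_filter, Finset.mem_univ, true_and] at hk ⊢
  refine lt_of_le_of_lt ?_ hk
  by_contra hlt
  exact chaosLT_asymm h (he _ _ (not_le.1 hlt))

/-! ### The modified cut norm -/

section Cut

variable {d n : ℕ}

theorem mem_chaosIndexUpTo {j : Fin d → ℕ} :
    j ∈ chaosIndexUpTo d n ↔ (∀ k, j k ∈ Finset.Icc 1 n) ∧ StrictMono j := by
  simp [chaosIndexUpTo]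

theorem tuplePoly_indicator {ι : Type} [Fintype ι] (j : ι → Fin d → ℕ) (b : ι → ℝ)
    (I : Finset ℕ) :
    tuplePoly j b (fun m => if m ∈ I then 1 else 0) = ∑ i with ∀ k, j i k ∈ I, b i := by
  rw [tuplePoly, Finset.sum_filter]
  refine Finset.sum_congr rfl fun i _ => ?_
  rw [Finset.prod_boole]
  simp

/-- A cut sum is the value of the polynomial at an indicator vector, a point of the cube `[-1,1]^N`.
-/
theorem modifiedCutNorm_le (b : chaosIndexUpTo d n → ℝ) (K : ℝ)
    (hK : ∀ ε : ℕ → ℝ, (∀ m, |ε m| = 1) → |tuplePoly (fun j : chaosIndexUpTo d n => j.1) b ε| ≤ K) :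
    modifiedCutNorm b ≤ K := by
  refine Finset.sup'_le _ _ fun I _ => ?_
  rw [← tuplePoly_indicator (fun j : chaosIndexUpTo d n => j.1)]
  exact abs_tuplePoly_le_of_abs_le_one (fun j => (mem_chaosIndexUpTo.1 j.2).2) hK
    fun m => by split_ifs <;> simp

theorem exists_abs_tuplePoly_le_modifiedCutNorm (d : ℕ) :
    ∃ C : ℝ, 0 < C ∧ ∀ (n : ℕ) (b : chaosIndexUpTo d n → ℝ) (ε : ℕ → ℝ), (∀ m, |ε m| = 1) →
      |tuplePoly (fun j : chaosIndexUpTo d n => j.1) b ε| ≤ C * modifiedCutNorm b := by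
  obtain ⟨C, hC, h⟩ := exists_abs_chaosPoly_le_of_indicator d
  refine ⟨C, hC, fun n b => ?_⟩
  have hj : ∀ j : chaosIndexUpTo d n, StrictMono j.1 := fun j => (mem_chaosIndexUpTo.1 j.2).2
  simp only [← chaosPoly_entries hj]
  refine h _ b _ (fun i => (card_entries (hj i)).le) fun x hx => ?_
  set I := (Finset.Icc 1 n).filter fun m => x m = 1 with hI
  rw [chaosPoly_entries hj]
  have e : tuplePoly (fun j : chaosIndexUpTo d n => j.1) b x
      = tuplePoly (fun j : chaosIndexUpTo d n => j.1) b (fun m => if m ∈ I then 1 else 0) := by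
    refine Finset.sum_congr rfl fun i _ => ?_
    congr 1
    refine Finset.prod_congr rfl fun k _ => ?_
    have hk := (mem_chaosIndexUpTo.1 i.2).1 k
    rcases hx (i.1 k) with h | h <;> simp [hI, hk, h]
  rw [e, tuplePoly_indicator]
  exact Finset.le_sup' (fun I => |∑ j : chaosIndexUpTo d n with ∀ k, j.1 k ∈ I, b j|)
    (Finset.mem_powerset.2 (Finset.filter_subset (fun m => x m = 1) (Finset.Icc 1 n)))

/-- The extra term `l = 0` is an empty sum, since entries are at least `1`. -/
theorem sum_Icc_sqrt_eq (a : chaosIndexUpTo d n → ℝ) (k : Fin d) :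
    ∑ l ∈ Finset.Icc 1 n, √(∑ j : chaosIndexUpTo d n with j.1 k = l, a j ^ 2)
      = ∑ l ∈ Finset.range (n + 1), √(∑ j : chaosIndexUpTo d n with j.1 k = l, a j ^ 2) := by
  refine Finset.sum_subset (fun l hl => ?_) fun l _ hl => ?_
  · simp only [Finset.mem_Icc, Finset.mem_range] at hl ⊢
    omega
  · rw [Finset.sum_eq_zero, Real.sqrt_zero]
    intro j hj
    exact absurd ((Finset.mem_filter.1 hj).2 ▸ (mem_chaosIndexUpTo.1 j.2).1 k) hl

theorem maxMixedNorm_sign_mul (a : chaosIndexUpTo d n → ℝ) (θ : chaosIndexUpTo d n → ℤˣ) :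
    maxMixedNorm (fun j => ((θ j : ℤ) : ℝ) * a j) = maxMixedNorm a := by
  have : ∀ j, (((θ j : ℤ) : ℝ) * a j) ^ 2 = a j ^ 2 := fun j => by
    rcases Int.units_eq_one_or (θ j) with h | h <;> simp [h]
  simp only [maxMixedNorm, this]

theorem signMean_modifiedCutNorm_le (hd : 1 ≤ d) (a : chaosIndexUpTo d n → ℝ) :
    signMean modifiedCutNorm a ≤ 2 ^ d * d * maxMixedNorm a := by
  refine (signMean_le_sum_mixedNorms hd (N := n + 1) (j := fun j : chaosIndexUpTo d n => j.1)
    (fun j k => ?_) modifiedCutNorm_le a).trans ?_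
  · have := Finset.mem_Icc.1 ((mem_chaosIndexUpTo.1 j.2).1 k)
    omega
  · rw [mul_assoc]
    gcongr
    calc _ ≤ ∑ _k : Fin d, maxMixedNorm a := by
          gcongr with k
          rw [← sum_Icc_sqrt_eq]
          exact le_ciSup_of_finite (fun k : Fin d => ∑ l ∈ Finset.Icc 1 n,
            √(∑ j : chaosIndexUpTo d n with j.1 k = l, a j ^ 2)) k
      _ = _ := by simp

theorem exists_maxMixedNorm_le_signMin (hd : 1 ≤ d) :
    ∃ C : ℝ, 0 < C ∧ ∀ (n : ℕ) (a : chaosIndexUpTo d n → ℝ),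
      maxMixedNorm a ≤ C * signMin modifiedCutNorm a := by
  obtain ⟨C₁, hC₁, h₁⟩ := exists_incidenceNorm_entries_le d
  obtain ⟨C₂, hC₂, h₂⟩ := exists_abs_tuplePoly_le_modifiedCutNorm d
  have : Nonempty (Fin d) := ⟨⟨0, hd⟩⟩
  refine ⟨C₁ * C₂, by positivity, fun n a => ?_⟩
  -- Applied below to every signed array `θ a`; the mixed norm does not see `θ`, so the bound holds
  -- for the minimum.
  have key : ∀ b : chaosIndexUpTo d n → ℝ, maxMixedNorm b ≤ C₁ * C₂ * modifiedCutNorm b := by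
    intro b
    refine ciSup_le fun k => ?_
    rw [sum_Icc_sqrt_eq, mul_assoc]
    refine (sum_sqrt_le_incidenceNorm (fun j : chaosIndexUpTo d n => j.1) b (n + 1) k).trans
      (h₁ b _ _ (fun j => (mem_chaosIndexUpTo.1 j.2).2) Subtype.val_injective (fun j k => ?_)
        (h₂ n b))
    have := Finset.mem_Icc.1 ((mem_chaosIndexUpTo.1 j.2).1 k)
    omega
  rw [← div_le_iff₀' (by positivity)]
  refine Finset.le_inf' _ _ fun θ _ => ?_
  rw [div_le_iff₀' (by positivity), ← maxMixedNorm_sign_mul a θ]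
  exact key _

end Cut

theorem signMin_le_signMean {ι : Type} [Fintype ι] [DecidableEq ι] (F : (ι → ℝ) → ℝ)
    (b : ι → ℝ) : signMin F b ≤ signMean F b := by
  rw [signMean, ← Fintype.expect_const (ι := ι → ℤˣ) (signMin F b)]
  exact Finset.expect_le_expect fun θ hθ => Finset.inf'_le _ hθ

end

theorem mainTheorem5 (d : ℕ) (hd : 1 ≤ d) :
    (∃ e : ℕ ≃ chaosIndex d,
      (∀ m m' : ℕ, m < m' → chaosLT (e m).1 (e m').1) ∧
      IsRUCSystem (fun m => chaosFun (e m).1)) ∧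
    (∃ C : ℝ, 0 < C ∧ ∀ (n : ℕ) (a : chaosIndexUpTo d n → ℝ),
      signMean (fun b => ‖∑ j : chaosIndexUpTo d n, b j • chaosFun j.1‖) a
        ≤ C * ‖∑ j : chaosIndexUpTo d n, a j • chaosFun j.1‖) ∧
    (∃ c C : ℝ, 0 < c ∧ 0 < C ∧ ∀ n : ℕ, d ≤ n → ∀ a : chaosIndexUpTo d n → ℝ,
      (c * signMean modifiedCutNorm a ≤ signMin modifiedCutNorm a ∧
        signMin modifiedCutNorm a ≤ C * signMean modifiedCutNorm a) ∧
      (c * signMin modifiedCutNorm a ≤ maxMixedNorm a ∧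
        maxMixedNorm a ≤ C * signMin modifiedCutNorm a)) := by
  obtain ⟨D, hD, hruc⟩ := exists_signMean_le hd
  refine ⟨?_, ?_, ?_⟩
  · obtain ⟨e, he⟩ := exists_equiv_chaosIndex hd
    refine ⟨e, he, isBasicSequence_chaosFun e he, D, hD, fun n a => ?_⟩
    set j : Fin n → Fin d → ℕ := fun k => (e k).1
    exact hruc (j := j) (fun b => ‖∑ k : Fin n, b k • chaosFun (j k)‖) a _
      (fun k => (e k).2.2) (fun k k' h => Fin.ext (e.injective (Subtype.ext h)))
      (fun b K hK => norm_sum_smul_chaosFun_le j b hK)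
      (abs_tuplePoly_le_norm j a fun k => (e k).2.1)
  · refine ⟨D, hD, fun n a => ?_⟩
    exact hruc (j := fun j : chaosIndexUpTo d n => j.1)
      (fun b => ‖∑ j : chaosIndexUpTo d n, b j • chaosFun j.1‖) a _
      (fun j => (mem_chaosIndexUpTo.1 j.2).2) Subtype.val_injective
      (fun b K hK => norm_sum_smul_chaosFun_le _ b hK)
      (abs_tuplePoly_le_norm _ a fun j k =>
        (Finset.mem_Icc.1 ((mem_chaosIndexUpTo.1 j.2).1 k)).1)
  · obtain ⟨L, hL, h⟩ := exists_maxMixedNorm_le_signMin hd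
    have hU : (0 : ℝ) < 2 ^ d * d := by positivity
    set U : ℝ := 2 ^ d * d
    refine ⟨min (1 / (U * L)) (1 / U), max 1 L, by positivity, by positivity, fun n _ a => ?_⟩
    have h1 : signMean modifiedCutNorm a ≤ U * maxMixedNorm a := signMean_modifiedCutNorm_le hd a
    have h2 := h n a
    have h3 := signMin_le_signMean modifiedCutNorm a
    have hM : 0 ≤ maxMixedNorm a :=
      Real.iSup_nonneg fun _ => Finset.sum_nonneg fun _ _ => Real.sqrt_nonneg _
    -- A negative minimum would contradict `0 ≤ maxMixedNorm a` and `h2`.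
    have hmin : 0 ≤ signMin modifiedCutNorm a := by
      by_contra hneg
      nlinarith
    have hmean := hmin.trans h3
    refine ⟨⟨?_, ?_⟩, ?_, ?_⟩
    · calc _ ≤ 1 / (U * L) * signMean modifiedCutNorm a := by gcongr; exact min_le_left _ _
        _ ≤ 1 / (U * L) * (U * (L * signMin modifiedCutNorm a)) := by
          gcongr; exact h1.trans (by gcongr)
        _ = _ := by field_simp
    · exact h3.trans (le_mul_of_one_le_left hmean (le_max_left _ _))
    · calc _ ≤ 1 / U * signMin modifiedCutNorm a := by gcongr; exact min_le_right _ _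
        _ ≤ 1 / U * (U * maxMixedNorm a) := by gcongr; exact h3.trans h1
        _ = _ := by field_simp
    · exact h2.trans (by gcongr; exact le_max_right _ _)
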